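/- Let $\mathbb K\in\{\mathbb R,\mathbb C\}$, $a<b$, and consider the boundary control system on $[a,b]$ $$\partial_t x=P_1\partial_\xi(\mathcal Hx)+P_0(\mathcal Hx),\qquad u(t)=\widetilde W_B\begin{bmatrix}(\mathcal Hx)(b,t)\\(\mathcal Hx)(a,t)\end{bmatrix},\qquad y(t)=\widetilde W_C\begin{bmatrix}(\mathcal Hx)(b,t)\\(\mathcal Hx)(a,t)\end{bmatrix},$$ where $P_1\in\mathbb K^{n\times n}$ is invertible and self-adjoint; $P_0,\mathcal H\in L^\infty([a,b],\mathbb K^{n\times n})$; $\mathcal H(\xi)$ is self-adjoint with $c_1I\le\mathcal H(\xi)\le c_2I$ for almost all $\xi$ and some constants $c_1,c_2>0$; $\widetilde W_B\in\mathbb K^{n\times 2n}$ and $\begin{bmatrix}\widetilde W_B\\\widetilde W_C\end{bmatrix}\in\mathbb K^{2n\times2n}$ have full rank; and the operator $A=P_1\partial_\xi\mathcal H+P_0\mathcal H$ with domain $\{x\in L^2([a,b],\mathbb K^n): \mathcal Hx\in H^1,\ \widetilde W_B\begin{bmatrix}(\mathcal Hx)(b)\\(\mathcal Hx)(a)\end{bmatrix}=0\}$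 generates a $C_0$-semigroup on $L^2([a,b],\mathbb K^n)$. Assume that there are $S,\mathcal H^D\in C^1([a,b],\mathbb K^{n\times n})$, with $S$ pointwise invertible and $\mathcal H^D$ diagonal with positive diagonal entries, and $0\le m\le n$ such that $P_1\mathcal H=S^{-1}P_1^D\mathcal H^DS$ with $P_1^D=\operatorname{diag}(I_m,-I_{n-m})$, and that $P_0^D:=S\big[(S^{-1})'+P_0P_1^{-1}S^{-1}\big]P_1^D$ vanishes almost everywhere on $[a,b]$. The diagonalised system is the system of the above form with coefficients $P_1^D$, $P_0^D=0$, $\mathcal H^D$, $\widetilde W_B^D=\widetilde W_BR$, $\widetilde W_C^D=\widetilde W_CR$, where $R=\operatorname{diag}\big(P_1^{-1}S(b)^{-1}P_1^D,\;P_1^{-1}S(a)^{-1}P_1^D\big)$. For the diagonalised system let $Q_+=\operatorname{diag}(I_m,0)$ and $Q_-=\operatorname{diag}(0,I_{n-m})$ (the positive square roots of $\pm P_1^D$ on its positive, respectively negative, spectral subspace, extended by $0$), let $\Psi^s_\zeta$ be the fundamental solution of $v'=s(P_1^D)^{-1}(\mathcal H^D)^{-1}v$ on $[a,b]$ with $\Psi^s_a=I$,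 and let $\mathbf U(s)=(Q_++Q_-\Psi^s_b)(Q_-+Q_+\Psi^s_b)^{-1}$. For a function $g$ of a complex variable, $\|g\|_{\mathcal M}$ denotes the total variation of the complex Borel measure of bounded variation on $[0,\infty)$ whose Laplace transform agrees with $g$ on some right half-plane ($\infty$ if there is none). $|M|$ denotes the matrix with entries $|M_{ij}|$. A system is called BIBO stable if there is $c>0$ such that $\|y\|_{L^\infty[0,t]}\le c\,\|u\|_{L^\infty[0,t]}$ for all $t>0$ and all classical solutions $(u,x,y)$ (that is, $u,y$ continuous, $x\in C^1([0,\infty),L^2([a,b],\mathbb K^n))$) with $u\in C_c^\infty([0,\infty),\mathbb K^n)$ and $x(0)=0$. **Theorem.** There are matrices $K,M\in\mathbb K^{n\times n}$ with $K$ invertible and $\widetilde W_B^D=K\begin{pmatrix}Q_+-MQ_-&Q_--MQ_+\end{pmatrix}$. For any such $K,M$, if at least one of the conditions 1. $\|M\|_{\ell^\infty\to\ell^\infty}<1$; 2. $\sum_{k=0}^\infty|M|^k$ converges; 3. there is $k_0>0$ such that $\sum_{r=1}^n\big\|\big((M\mathbf U(s))^{k_0}\big)_{p,r}\big\|_{\mathcal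 M}<1$ for all $1\le p\le n$ holds, then $\sum_{k=0}^\infty\big\|\big((M\mathbf U(s))^{k}\big)_{p,q}\big\|_{\mathcal M}<\infty$ for all $1\le p,q\le n$, and both the diagonalised system and the original system are BIBO stable. Moreover, condition 2 holds whenever $\|\,|M|\,\|<1$ for some submultiplicative norm on $\mathbb K^{n\times n}$. -/

import Mathlib

open MeasureTheory Set Filter Topology Matrix
open scoped NNReal ENNReal ContDiff ComplexOrder

noncomputable section

/-! ### Strongly continuous semigroups -/

/-- The linear operator with graph `G` (`G x y` means `x ∈ D(A)` and `A x = y`) is the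
infinitesimal generator of a strongly continuous one-parameter semigroup on `X`. -/
def GeneratesC0Semigroup (𝕜 : Type*) [RCLike 𝕜] {X : Type*} [NormedAddCommGroup X]
    [NormedSpace 𝕜 X] (G : X → X → Prop) : Prop :=
  ∃ T : ℝ≥0 → X →L[𝕜] X,
    T 0 = 1 ∧ (∀ s t, T (s + t) = T s * T t) ∧ (∀ x, Continuous fun t => T t x) ∧
    ∀ x y, G x y ↔ Tendsto (fun t : ℝ≥0 => ((t : ℝ) : 𝕜)⁻¹ • (T t x - x)) (𝓝[>] 0) (𝓝 y)

/-! ### Inverse Laplace transforms and their total variation -/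

/-- `μ` is a complex Borel measure of bounded total variation on `[0, ∞)` whose Laplace transform
agrees with `g` on some right half-plane. The half-plane may be shrunk, so it is taken inside
`{Re s > 0}`, where the integral always converges. -/
def IsInverseLaplace (μ : ComplexMeasure ℝ≥0) (g : ℂ → ℂ) : Prop :=
  μ.variation univ ≠ ⊤ ∧ ∃ α : ℝ, 0 ≤ α ∧ ∀ s : ℂ, α < s.re →
    μ.integral (fun t : ℝ≥0 => Complex.exp (-s * ((t : ℝ) : ℂ))) (ContinuousLinearMap.mul ℝ ℂ) = g s

/-- The total variation of the inverse Laplace transform of `g`. The inverse transform is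
unique if it exists, so the infimum is over at most one measure; the value is `∞` if `g` is not the
Laplace transform of a measure of bounded total variation. -/
def laplaceVariation (g : ℂ → ℂ) : ℝ≥0∞ :=
  ⨅ (μ : ComplexMeasure ℝ≥0) (_ : IsInverseLaplace μ g), μ.variation univ

/-! ### Matrix notions -/

/-- The norm of `M` as an operator from `ℓ^∞` to `ℓ^∞`
(the norm of `Fin n → 𝕜` is the maximum norm). -/
def normInftyInfty {𝕜 : Type*} [RCLike 𝕜] {n : ℕ} (M : Matrix (Fin n) (Fin n) 𝕜) : ℝ :=
  ‖LinearMap.toContinuousLinearMap (Matrix.mulVecLin M)‖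

/-- The matrix of the absolute values of the entries. -/
def absMatrix {𝕜 : Type*} [RCLike 𝕜] {n : ℕ} (M : Matrix (Fin n) (Fin n) 𝕜) :
    Matrix (Fin n) (Fin n) 𝕜 :=
  M.map fun z => ((‖z‖ : ℝ) : 𝕜)

/-- Entrywise inclusion of `𝕜`, which is `ℝ` or `ℂ`, into `ℂ`. -/
def complexify {𝕜 : Type*} [RCLike 𝕜] {n : ℕ} (M : Matrix (Fin n) (Fin n) 𝕜) :
    Matrix (Fin n) (Fin n) ℂ :=
  M.map (RCLike.map 𝕜 ℂ)

/-! ### Hyperbolic boundary control systems -/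

/-- The data of the system
`∂ₜ x = P₁ ∂_ξ (H x) + P₀ (H x)` on `[a, b]`,
`u = W_B [(H x)(b); (H x)(a)]`, `y = W_C [(H x)(b); (H x)(a)]`. -/
structure HBCS (𝕜 : Type*) [RCLike 𝕜] (n : ℕ) where
  a : ℝ
  b : ℝ
  hab : a < b
  P1 : Matrix (Fin n) (Fin n) 𝕜
  P0 : ℝ → Matrix (Fin n) (Fin n) 𝕜
  H : ℝ → Matrix (Fin n) (Fin n) 𝕜
  WB : Matrix (Fin n) (Fin n ⊕ Fin n) 𝕜
  WC : Matrix (Fin n) (Fin n ⊕ Fin n) 𝕜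

namespace HBCS

variable {𝕜 : Type*} [RCLike 𝕜] {n : ℕ} (sys : HBCS 𝕜 n)

/-- Lebesgue measure on `[a, b]`. -/
abbrev vol : Measure ℝ := volume.restrict (Icc sys.a sys.b)

/-- The state space `L²([a, b], 𝕜ⁿ)`. Since `m I ≤ H ≤ M I`, the inner product weighted by `H`
induces an equivalent norm, so that strong continuity, generators and differentiability are the
same for both. -/
abbrev State : Type _ := Lp (EuclideanSpace 𝕜 (Fin n)) 2 sys.vol

/-- The vector `[v(b); v(a)]` of boundary values. -/
def trace (v : ℝ → EuclideanSpace 𝕜 (Fin n)) : Fin n ⊕ Fin n → 𝕜 :=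
  Sum.elim (v sys.b).ofLp (v sys.a).ofLp

/-- `v ∈ H¹([a, b], 𝕜ⁿ)` (as its continuous representative) with weak derivative `w ∈ L²`. -/
def HasH1Deriv (v w : ℝ → EuclideanSpace 𝕜 (Fin n)) : Prop :=
  MemLp w 2 sys.vol ∧ ∀ ξ ∈ Icc sys.a sys.b, v ξ = v sys.a + ∫ ζ in sys.a..ξ, w ζ

/-- `H x ∈ H¹` with continuous representative `v`, and `P₁ ∂_ξ (H x) + P₀ (H x) = z`. -/
def Evolution (x z : sys.State) (v : ℝ → EuclideanSpace 𝕜 (Fin n)) : Prop :=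
  ∃ w : ℝ → EuclideanSpace 𝕜 (Fin n), sys.HasH1Deriv v w ∧
    (∀ᵐ ξ ∂sys.vol, (v ξ).ofLp = sys.H ξ *ᵥ (x ξ).ofLp) ∧
    (∀ᵐ ξ ∂sys.vol, (z ξ).ofLp = sys.P1 *ᵥ (w ξ).ofLp + sys.P0 ξ *ᵥ (v ξ).ofLp)

/-- The graph of the operator `A = P₁ ∂_ξ H + P₀ H` with domain
`{x | H x ∈ H¹, W_B [(H x)(b); (H x)(a)] = 0}`. -/
def operatorGraph (x z : sys.State) : Prop :=
  ∃ v : ℝ → EuclideanSpace 𝕜 (Fin n), sys.Evolution x z v ∧ sys.WB *ᵥ sys.trace v = 0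

/-- The standing assumptions on the system. -/
structure Admissible : Prop where
  P1_unit : IsUnit sys.P1
  P1_selfAdjoint : sys.P1.IsHermitian
  P0_bounded : ∀ i j, MemLp (fun ξ => sys.P0 ξ i j) ⊤ sys.vol
  H_bounded : ∀ i j, MemLp (fun ξ => sys.H ξ i j) ⊤ sys.vol
  H_selfAdjoint : ∀ᵐ ξ ∂sys.vol, (sys.H ξ).IsHermitian
  H_bounds : ∃ m M : ℝ, 0 < m ∧ 0 < M ∧ ∀ᵐ ξ ∂sys.vol,
    (sys.H ξ - (m : 𝕜) • (1 : Matrix (Fin n) (Fin n) 𝕜)).PosSemidef ∧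
    ((M : 𝕜) • (1 : Matrix (Fin n) (Fin n) 𝕜) - sys.H ξ).PosSemidef
  WB_rank : sys.WB.rank = n
  WBC_rank : (Matrix.fromRows sys.WB sys.WC).rank = n + n
  generates : GeneratesC0Semigroup 𝕜 sys.operatorGraph

/-- `(u, x, y)` is a classical solution on `[0, ∞)`: `u`, `y` are continuous, `x` is `C¹` with
values in the state space, and the equations hold for every `t ≥ 0`. -/
def IsClassicalSolution (u : ℝ → EuclideanSpace 𝕜 (Fin n)) (x : ℝ → sys.State)
    (y : ℝ → EuclideanSpace 𝕜 (Fin n)) : Prop :=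
  ContinuousOn u (Ici 0) ∧ ContDiffOn ℝ 1 x (Ici 0) ∧ ContinuousOn y (Ici 0) ∧
    ∀ t, 0 ≤ t → ∃ v : ℝ → EuclideanSpace 𝕜 (Fin n),
      sys.Evolution (x t) (derivWithin x (Ici 0) t) v ∧
      (u t).ofLp = sys.WB *ᵥ sys.trace v ∧ (y t).ofLp = sys.WC *ᵥ sys.trace v

/-- BIBO stability: a uniform bound `‖y‖_{L^∞[0,t]} ≤ c ‖u‖_{L^∞[0,t]}` for all classical solutions
with `u ∈ C_c^∞([0, ∞))` and `x(0) = 0`. -/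
def BIBOStable : Prop :=
  ∃ c : ℝ, 0 < c ∧ ∀ u x y, sys.IsClassicalSolution u x y →
    ContDiffOn ℝ ∞ u (Ici 0) → (∃ R : ℝ, ∀ t, R < t → u t = 0) → x 0 = 0 →
    ∀ t : ℝ, 0 < t →
      eLpNorm y ⊤ (volume.restrict (Icc 0 t)) ≤
        ENNReal.ofReal c * eLpNorm u ⊤ (volume.restrict (Icc 0 t))

/-! ### Decomposition of the input matrix, fundamental solution -/

/-- `Q₊`: the square root of `P₁` on the span of the eigenvectors with positive eigenvalue, zero on
the span of those with negative eigenvalue (`√r = 0` for `r ≤ 0`). -/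
def Qplus : Matrix (Fin n) (Fin n) 𝕜 := cfc (fun r : ℝ => Real.sqrt r) sys.P1

/-- `Q₋`: the square root of `-P₁` on the span of the eigenvectors with negative eigenvalue, zero on
the span of those with positive eigenvalue. -/
def Qminus : Matrix (Fin n) (Fin n) 𝕜 := cfc (fun r : ℝ => Real.sqrt (-r)) sys.P1

/-- `W_B = K (Q₊ - M Q₋, Q₋ - M Q₊)` with `K` invertible. -/
def IsDecomposition (K M : Matrix (Fin n) (Fin n) 𝕜) : Prop :=
  IsUnit K ∧ sys.WB =
    K * Matrix.fromCols (sys.Qplus - M * sys.Qminus) (sys.Qminus - M * sys.Qplus)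

/-- `Ψ` is the fundamental solution on `[a, b]`, `Ψ(a) = I`, of
`v' = -P₁⁻¹ (P₀ - s H⁻¹) v`; as the coefficients are only bounded and measurable,
the equation is understood in integrated form. -/
def IsFundamentalSolution (s : ℂ) (Ψ : ℝ → Matrix (Fin n) (Fin n) ℂ) : Prop :=
  ContinuousOn Ψ (Icc sys.a sys.b) ∧ ∀ ζ ∈ Icc sys.a sys.b, ∀ i j,
    Ψ ζ i j = (1 : Matrix (Fin n) (Fin n) ℂ) i j +
      ∫ τ in sys.a..ζ, (-(complexify sys.P1)⁻¹ *
        (complexify (sys.P0 τ) - s • (complexify (sys.H τ))⁻¹) * Ψ τ) i j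

/-- The fundamental solution `Ψ_ζ^s` (it exists and is unique on `[a, b]`). -/
def fundamentalSolution (s : ℂ) : ℝ → Matrix (Fin n) (Fin n) ℂ :=
  Classical.epsilon (sys.IsFundamentalSolution s)

/-- `V(s) = Q₋ + Q₊ Ψ_b^s`. -/
def V (s : ℂ) : Matrix (Fin n) (Fin n) ℂ :=
  complexify sys.Qminus + complexify sys.Qplus * sys.fundamentalSolution s sys.b

/-- `U(s) = (Q₊ + Q₋ Ψ_b^s) V(s)⁻¹`. -/
def U (s : ℂ) : Matrix (Fin n) (Fin n) ℂ :=
  (complexify sys.Qplus + complexify sys.Qminus * sys.fundamentalSolution s sys.b) * (sys.V s)⁻¹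

/-- The total variation of the inverse Laplace transform of the `(p, q)` entry of
`(M U(s))^k`. -/
def powVariation (M : Matrix (Fin n) (Fin n) 𝕜) (k : ℕ) (p q : Fin n) : ℝ≥0∞ :=
  laplaceVariation fun s => ((complexify M * sys.U s) ^ k) p q

/-! ### Diagonalisation -/

/-- `P₁^D = diag(I_m, -I_{n-m})`. -/
def P1D (𝕜 : Type*) [RCLike 𝕜] (n m : ℕ) : Matrix (Fin n) (Fin n) 𝕜 :=
  Matrix.diagonal fun i => if (i : ℕ) < m then 1 else -1

/-- A `C¹` diagonalisation `P₁ H = S⁻¹ P₁^D H^D S`, where `S` is pointwise invertible and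
`H^D = diag(h₁, …, hₙ)` is positive. -/
structure Diagonalisation where
  m : ℕ
  m_le : m ≤ n
  S : ℝ → Matrix (Fin n) (Fin n) 𝕜
  h : ℝ → Fin n → ℝ
  S_contDiff : ∀ i j, ContDiffOn ℝ 1 (fun ξ => S ξ i j) (Icc sys.a sys.b)
  S_unit : ∀ ξ ∈ Icc sys.a sys.b, IsUnit (S ξ)
  h_contDiff : ∀ i, ContDiffOn ℝ 1 (fun ξ => h ξ i) (Icc sys.a sys.b)
  h_pos : ∀ ξ ∈ Icc sys.a sys.b, ∀ i, 0 < h ξ i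
  eq : ∀ᵐ ξ ∂sys.vol, sys.P1 * sys.H ξ =
    (S ξ)⁻¹ * P1D 𝕜 n m * Matrix.diagonal (fun i => (h ξ i : 𝕜)) * S ξ

variable {sys}

namespace Diagonalisation

variable (D : sys.Diagonalisation)

/-- The entrywise derivative of `ξ ↦ S(ξ)⁻¹` on `[a, b]`. -/
def derivSInv (ξ : ℝ) : Matrix (Fin n) (Fin n) 𝕜 :=
  Matrix.of fun i j => derivWithin (fun ζ => (D.S ζ)⁻¹ i j) (Icc sys.a sys.b) ξ

/-- `P₀^D = S [(S⁻¹)' + P₀ P₁⁻¹ S⁻¹] P₁^D`. -/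
def P0D (ξ : ℝ) : Matrix (Fin n) (Fin n) 𝕜 :=
  D.S ξ * (D.derivSInv ξ + sys.P0 ξ * sys.P1⁻¹ * (D.S ξ)⁻¹) * P1D 𝕜 n D.m

/-- The block diagonal matrix `diag(P₁⁻¹ S⁻¹(b) P₁^D, P₁⁻¹ S⁻¹(a) P₁^D)`. -/
def boundaryTransform : Matrix (Fin n ⊕ Fin n) (Fin n ⊕ Fin n) 𝕜 :=
  Matrix.fromBlocks (sys.P1⁻¹ * (D.S sys.b)⁻¹ * P1D 𝕜 n D.m) 0
    0 (sys.P1⁻¹ * (D.S sys.a)⁻¹ * P1D 𝕜 n D.m)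

/-- The diagonalised system, obtained by the state transformation `x ↦ S x`. -/
def system : HBCS 𝕜 n where
  a := sys.a
  b := sys.b
  hab := sys.hab
  P1 := P1D 𝕜 n D.m
  P0 := D.P0D
  H := fun ξ => Matrix.diagonal fun i => (D.h ξ i : 𝕜)
  WB := sys.WB * D.boundaryTransform
  WC := sys.WC * D.boundaryTransform

end Diagonalisation

end HBCS

end

open MeasureTheory Set Filter Topology Matrix
open scoped NNReal ENNReal ContDiff ComplexOrder

/-! When `P₀^D` vanishes, the components decouple inside the interval: the `i`-th effort variable is
carried unchanged from its inflow end to its outflow end in the travel time `τᵢ = ∫ 1 / hᵢ`.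
Coupling happens only at the boundary, where the input equation reads `u = K (inflow - M outflow)`.
So the inflow `f` solves the delay equation `f_p(t) = ∑_q M_pq f_q(t - τ_q) + (K⁻¹ u)_p(t)`. The
delays are bounded below by some `δ > 0` and `f` vanishes before time zero, so finitely many
substitutions express `f(t)` through `u` alone. The operators that appear are the powers of `M`
times the diagonal of delays, and the resulting bound is uniform in time once the `ℓ¹` norms of
their entries are summable. The output is a fixed linear image of the boundary values, whence
`bibo_of_summable`.

The same powers appear on the Laplace side. Here `U(s)` is the diagonal matrix of the `e^{-s τᵢ}`
(`system_U`), so the entries of `(M U)^k` are exponential polynomials `∑ c_d e^{-sd}`, and the total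
variation of the inverse transform is exactly `∑ |c_d|` (`laplaceVariation_eval`). Conditions 1 and
3 make some power a contraction for the maximal row sum; condition 2 dominates all powers entrywise.
Each therefore gives summability.

The existence of `K` and `M` reduces to invertibility of the coefficient of the inflow in the input
(`isUnit_inflowMatrix`). If it were singular, a nontrivial combination of the outflows would vanish
along every trajectory with `u = 0`, and so a nonzero functional of the initial state would vanish
on the dense domain of the generator.

Solutions are not transformed to the diagonal system. The state is paired with rows of `S` weighted
by functions transported along the characteristics (`inner_shiftVec_balance`), which gives the
transport law in weak form (`outflow_eq_inflow_delayed`). The diagonalised system is covered by its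
trivial diagonalisation `self`. -/

noncomputable section

/-! ### The `ℓ¹` norm on exponential polynomials -/

/-- The algebra of formal exponential polynomials `∑ c_d e^{-sd}` with exponents `d ≥ 0`. -/
abbrev ExpPoly : Type := AddMonoidAlgebra ℂ ℝ≥0

namespace ExpPoly

/-- The sum of the absolute values of the coefficients. -/
def l1Norm (a : ExpPoly) : ℝ := ∑ d ∈ a.coeff.support, ‖a.coeff d‖

lemma l1Norm_nonneg (a : ExpPoly) : 0 ≤ l1Norm a := Finset.sum_nonneg fun _ _ => norm_nonneg _

lemma l1Norm_eq_sum_of_subset (a : ExpPoly) {s : Finset ℝ≥0} (hs : a.coeff.support ⊆ s) :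
    l1Norm a = ∑ d ∈ s, ‖a.coeff d‖ :=
  Finset.sum_subset hs fun d _ hd => by simp [Finsupp.notMem_support_iff.mp hd]

@[simp] lemma l1Norm_zero : l1Norm 0 = 0 := by simp [l1Norm]

lemma l1Norm_add_le (a b : ExpPoly) : l1Norm (a + b) ≤ l1Norm a + l1Norm b := by
  classical
  rw [l1Norm_eq_sum_of_subset (a + b) (s := a.coeff.support ∪ b.coeff.support)
      (by rw [AddMonoidAlgebra.coeff_add]; exact Finsupp.support_add),
    l1Norm_eq_sum_of_subset a Finset.subset_union_left,
    l1Norm_eq_sum_of_subset b Finset.subset_union_right, ← Finset.sum_add_distrib]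
  exact Finset.sum_le_sum fun d _ => by simpa using norm_add_le (a.coeff d) (b.coeff d)

lemma l1Norm_sum_le {ι : Type*} (s : Finset ι) (a : ι → ExpPoly) :
    l1Norm (∑ i ∈ s, a i) ≤ ∑ i ∈ s, l1Norm (a i) :=
  Finset.le_sum_of_subadditive l1Norm l1Norm_zero.le l1Norm_add_le s a

@[simp] lemma l1Norm_single (d : ℝ≥0) (c : ℂ) : l1Norm (AddMonoidAlgebra.single d c) = ‖c‖ := by
  classical
  rw [l1Norm_eq_sum_of_subset _ (s := {d})
    (by simpa [AddMonoidAlgebra.coeff_single] using Finsupp.support_single_subset)]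
  simp [AddMonoidAlgebra.coeff_single]

@[simp] lemma l1Norm_one : l1Norm 1 = 1 := by
  simp [AddMonoidAlgebra.one_def]

lemma l1Norm_mul_le (a b : ExpPoly) : l1Norm (a * b) ≤ l1Norm a * l1Norm b := by
  rw [AddMonoidAlgebra.mul_def, Finsupp.sum]
  refine (l1Norm_sum_le _ _).trans ?_
  rw [l1Norm, l1Norm, Finset.sum_mul_sum]
  refine Finset.sum_le_sum fun d _ => ?_
  rw [Finsupp.sum]
  refine (l1Norm_sum_le _ _).trans (Finset.sum_le_sum fun e _ => ?_)
  simp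

/-- The value `∑ c_d e^{-sd}` of an exponential polynomial. -/
def eval (s : ℂ) : ExpPoly →ₐ[ℂ] ℂ :=
  AddMonoidAlgebra.lift ℂ ℂ ℝ≥0
    { toFun := fun d => Complex.exp (-s * ((d.toAdd : ℝ) : ℂ))
      map_one' := by simp
      map_mul' := fun x y => by
        simp only [toAdd_mul, NNReal.coe_add, Complex.ofReal_add, mul_add, Complex.exp_add] }

lemma eval_apply (s : ℂ) (a : ExpPoly) :
    eval s a = ∑ d ∈ a.coeff.support, a.coeff d * Complex.exp (-s * ((d : ℝ) : ℂ)) := by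
  simp [eval, AddMonoidAlgebra.lift_apply, Finsupp.sum]

@[simp] lemma eval_single (s : ℂ) (d : ℝ≥0) (c : ℂ) :
    eval s (AddMonoidAlgebra.single d c) = c * Complex.exp (-s * ((d : ℝ) : ℂ)) := by
  simp [eval]

/-- The action of exponential polynomials on functions of time, where `e^{-sd}` is the delay
by `d`. -/
def delay : ExpPoly →ₐ[ℂ] Module.End ℂ (ℝ → ℂ) :=
  AddMonoidAlgebra.lift ℂ (Module.End ℂ (ℝ → ℂ)) ℝ≥0
    { toFun := fun d =>
        { toFun := fun f t => f (t - (d.toAdd : ℝ))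
          map_add' := fun _ _ => rfl
          map_smul' := fun _ _ => rfl }
      map_one' := by ext f; simp
      map_mul' := fun x y => by
        refine LinearMap.ext fun f => funext fun t => ?_
        simp [sub_sub] }

lemma delay_apply (a : ExpPoly) (f : ℝ → ℂ) (t : ℝ) :
    delay a f t = ∑ d ∈ a.coeff.support, a.coeff d * f (t - d) := by
  simp [delay, AddMonoidAlgebra.lift_apply, Finsupp.sum, LinearMap.sum_apply, Finset.sum_apply]

@[simp] lemma delay_single (d : ℝ≥0) (c : ℂ) (f : ℝ → ℂ) (t : ℝ) :
    delay (AddMonoidAlgebra.single d c) f t = c * f (t - d) := by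
  simp [delay]

/-- Causality: the exponents are nonnegative, so only values of `f` up to time `t` enter. -/
lemma norm_delay_le (a : ExpPoly) {f : ℝ → ℂ} {t B : ℝ} (hf : ∀ s ≤ t, ‖f s‖ ≤ B) :
    ‖delay a f t‖ ≤ l1Norm a * B := by
  rw [delay_apply, l1Norm, Finset.sum_mul]
  refine (norm_sum_le _ _).trans (Finset.sum_le_sum fun d _ => ?_)
  rw [norm_mul]
  exact mul_le_mul_of_nonneg_left (hf _ (by simp)) (norm_nonneg _)

end ExpPoly

/-! ### Powers of matrices of exponential polynomials -/

section DelayMatrix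

open ExpPoly

variable {n : ℕ}

/-- The matrix `M diag(e^{-s τ₁}, …, e^{-s τₙ})` of exponential polynomials. -/
def delayMatrix (M : Matrix (Fin n) (Fin n) ℂ) (τ : Fin n → ℝ≥0) :
    Matrix (Fin n) (Fin n) ExpPoly :=
  Matrix.of fun p q => AddMonoidAlgebra.single (τ q) (M p q)

lemma map_eval_delayMatrix_pow (M : Matrix (Fin n) (Fin n) ℂ) (τ : Fin n → ℝ≥0) (s : ℂ) (k : ℕ)
    (p q : Fin n) :
    eval s ((delayMatrix M τ ^ k) p q) =
      ((M * Matrix.diagonal fun i => Complex.exp (-s * ((τ i : ℝ) : ℂ))) ^ k) p q := by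
  have h : (delayMatrix M τ).map (eval s) =
      M * Matrix.diagonal fun i => Complex.exp (-s * ((τ i : ℝ) : ℂ)) := by
    ext i j
    simp [delayMatrix]
  rw [← h]
  have := map_pow (RingHom.mapMatrix (m := Fin n) (eval s : ExpPoly →+* ℂ)) (delayMatrix M τ) k
  simpa using congr_fun (congr_fun this p) q

lemma l1Norm_pow_add_le (A : Matrix (Fin n) (Fin n) ExpPoly) (j k : ℕ) (p q : Fin n) :
    l1Norm ((A ^ (j + k)) p q) ≤ ∑ r, l1Norm ((A ^ j) p r) * l1Norm ((A ^ k) r q) := by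
  rw [pow_add, Matrix.mul_apply]
  exact (l1Norm_sum_le _ _).trans (Finset.sum_le_sum fun r _ => l1Norm_mul_le _ _)

/-- Paths with equal total delay may cancel, which only lowers the `ℓ¹` norm; the bound does not see
the delays at all. -/
lemma l1Norm_delayMatrix_pow_le (M : Matrix (Fin n) (Fin n) ℂ) (τ : Fin n → ℝ≥0) (k : ℕ)
    (p q : Fin n) :
    l1Norm ((delayMatrix M τ ^ k) p q) ≤ ((M.map fun z => ‖z‖) ^ k) p q := by
  induction k generalizing p q with
  | zero =>
    rw [pow_zero, pow_zero, Matrix.one_apply, Matrix.one_apply]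
    split_ifs <;> simp
  | succ k ih =>
    refine (l1Norm_pow_add_le _ _ _ _ _).trans ?_
    rw [pow_succ (M.map _), Matrix.mul_apply]
    refine Finset.sum_le_sum fun r _ => ?_
    rw [pow_one]
    exact (mul_le_mul_of_nonneg_right (ih p r) (l1Norm_nonneg _)).trans_eq (by simp [delayMatrix])

/-- A matrix of exponential polynomials one of whose powers has row sums of `ℓ¹` norms less than
`1` has entrywise summable powers. -/
lemma summable_l1Norm_pow (A : Matrix (Fin n) (Fin n) ExpPoly) {k₀ : ℕ} (hk₀ : 0 < k₀)
    (hA : ∀ p, ∑ r, l1Norm ((A ^ k₀) p r) < 1) (p q : Fin n) :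
    Summable fun k : ℕ => l1Norm ((A ^ k) p q) := by
  -- Finitely many strict inequalities give one contraction factor; the index `p` itself shows that
  -- the maximum is over a nonempty set.
  obtain ⟨θ, hθ0, hθ1, hθ⟩ : ∃ θ : ℝ, 0 ≤ θ ∧ θ < 1 ∧ ∀ p, ∑ r, l1Norm ((A ^ k₀) p r) ≤ θ := by
    have hne : (Finset.univ : Finset (Fin n)).Nonempty := ⟨p, Finset.mem_univ p⟩
    refine ⟨Finset.univ.sup' hne fun p => ∑ r, l1Norm ((A ^ k₀) p r), ?_, ?_, fun p => ?_⟩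
    · exact (Finset.sum_nonneg fun r _ => l1Norm_nonneg _).trans
        (Finset.le_sup' (fun p => ∑ r, l1Norm ((A ^ k₀) p r)) (Finset.mem_univ p))
    · exact (Finset.sup'_lt_iff hne).mpr fun p _ => hA p
    · exact Finset.le_sup' (fun p => ∑ r, l1Norm ((A ^ k₀) p r)) (Finset.mem_univ p)
  obtain ⟨C, hC⟩ : ∃ C : ℝ, ∀ r < k₀, ∀ i j, l1Norm ((A ^ r) i j) ≤ C := by
    refine ⟨∑ r ∈ Finset.range k₀, ∑ i, ∑ j, l1Norm ((A ^ r) i j), fun r hr i j => ?_⟩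
    calc l1Norm ((A ^ r) i j) ≤ ∑ j, l1Norm ((A ^ r) i j) :=
          Finset.single_le_sum (f := fun j => l1Norm ((A ^ r) i j))
            (fun _ _ => l1Norm_nonneg _) (Finset.mem_univ j)
      _ ≤ ∑ i, ∑ j, l1Norm ((A ^ r) i j) :=
          Finset.single_le_sum (f := fun i => ∑ j, l1Norm ((A ^ r) i j))
            (fun _ _ => Finset.sum_nonneg fun _ _ => l1Norm_nonneg _) (Finset.mem_univ i)
      _ ≤ _ := Finset.single_le_sum (f := fun r => ∑ i, ∑ j, l1Norm ((A ^ r) i j))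
            (fun _ _ => Finset.sum_nonneg fun _ _ => Finset.sum_nonneg fun _ _ => l1Norm_nonneg _)
            (Finset.mem_range.mpr hr)
  -- Each full block of `k₀` factors contributes `θ`; the remaining `r < k₀` factors are absorbed in
  -- `C`.
  have hbound : ∀ (m r : ℕ), r < k₀ → ∀ i j, l1Norm ((A ^ (k₀ * m + r)) i j) ≤ θ ^ m * C := by
    intro m
    induction m with
    | zero => intro r hr i j; simpa using hC r hr i j
    | succ m ih =>
      intro r hr i j
      have : k₀ * (m + 1) + r = k₀ + (k₀ * m + r) := by ring
      rw [this]
      refine (l1Norm_pow_add_le _ _ _ _ _).trans ?_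
      have hCnn : 0 ≤ θ ^ m * C := (l1Norm_nonneg _).trans (ih r hr i j)
      calc ∑ l, l1Norm ((A ^ k₀) i l) * l1Norm ((A ^ (k₀ * m + r)) l j)
          ≤ ∑ l, l1Norm ((A ^ k₀) i l) * (θ ^ m * C) :=
            Finset.sum_le_sum fun l _ => mul_le_mul_of_nonneg_left (ih r hr l j) (l1Norm_nonneg _)
        _ = (∑ l, l1Norm ((A ^ k₀) i l)) * (θ ^ m * C) := by rw [Finset.sum_mul]
        _ ≤ θ * (θ ^ m * C) := mul_le_mul_of_nonneg_right (hθ i) hCnn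
        _ = θ ^ (m + 1) * C := by ring
  have : NeZero k₀ := ⟨hk₀.ne'⟩
  have hCnn : 0 ≤ C := (l1Norm_nonneg _).trans (hC 0 hk₀ p p)
  -- Reindexing by quotient and remainder leaves finitely many copies of a geometric series.
  rw [← (Nat.divModEquiv k₀).symm.summable_iff]
  refine Summable.of_nonneg_of_le (fun _ => l1Norm_nonneg _) (fun x => ?_)
    ((summable_geometric_of_lt_one hθ0 hθ1).mul_of_nonneg
      (hasSum_fintype fun _ : Fin k₀ => C).summable (fun m => pow_nonneg hθ0 m) (fun _ => hCnn))
  have := hbound x.1 x.2 x.2.is_lt p q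
  rw [mul_comm k₀] at this
  simpa [Nat.divModEquiv] using this

end DelayMatrix

/-! ### Summability of the powers of the matrix of absolute values -/

section AbsMatrix

open ExpPoly

variable {𝕜 : Type*} [RCLike 𝕜] {n : ℕ}

lemma absMatrix_pow_apply (M : Matrix (Fin n) (Fin n) 𝕜) (k : ℕ) (p q : Fin n) :
    (absMatrix M ^ k) p q = ((((M.map fun z => ‖z‖) ^ k) p q : ℝ) : 𝕜) := by
  have h : absMatrix M = (M.map fun z => ‖z‖).map (algebraMap ℝ 𝕜) := by
    ext i j; simp [absMatrix]
  rw [h]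
  have := map_pow (RingHom.mapMatrix (m := Fin n) (algebraMap ℝ 𝕜)) (M.map fun z => ‖z‖) k
  simpa using (congr_fun (congr_fun this p) q).symm

lemma summable_absMatrix_pow_iff (M : Matrix (Fin n) (Fin n) 𝕜) :
    (Summable fun k : ℕ => absMatrix M ^ k) ↔
      ∀ p q, Summable fun k : ℕ => ((M.map fun z => ‖z‖) ^ k) p q := by
  have h1 : (Summable fun k : ℕ => absMatrix M ^ k) ↔
      ∀ p q, Summable fun k : ℕ => (absMatrix M ^ k) p q := by
    refine Pi.summable.trans (forall_congr' fun p => ?_)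
    exact Pi.summable
  rw [h1]
  refine forall_congr' fun p => forall_congr' fun q => ?_
  simp_rw [absMatrix_pow_apply]
  exact RCLike.summable_ofReal 𝕜

/-- An algebra norm controls the entries of a matrix. -/
lemma AlgebraNorm.exists_norm_entry_le (ν : AlgebraNorm 𝕜 (Matrix (Fin n) (Fin n) 𝕜))
    (p q : Fin n) : ∃ C : ℝ, ∀ A : Matrix (Fin n) (Fin n) 𝕜, ‖A p q‖ ≤ C * ν A := by
  have hpos : 0 < ν (Matrix.single p q (1 : 𝕜)) := by
    refine lt_of_le_of_ne (apply_nonneg ν _) fun h => ?_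
    have h0 := eq_zero_of_map_eq_zero ν h.symm
    simpa using congr_fun (congr_fun h0 p) q
  refine ⟨ν (Matrix.single p p (1 : 𝕜)) * ν (Matrix.single q q (1 : 𝕜)) /
    ν (Matrix.single p q (1 : 𝕜)), fun A => ?_⟩
  -- Compressing `A` by matrix units isolates one entry, and submultiplicativity then bounds it by
  -- `ν A`.
  have h : A p q • Matrix.single p q (1 : 𝕜) =
      Matrix.single p p 1 * A * Matrix.single q q 1 := by
    simp [Matrix.single_mul_mul_single, Matrix.smul_single]
  have h1 : ‖A p q‖ * ν (Matrix.single p q (1 : 𝕜)) ≤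
      ν (Matrix.single p p 1) * ν A * ν (Matrix.single q q 1) := by
    rw [← map_smul_eq_mul ν, h]
    exact (map_mul_le_mul ν _ _).trans
      (mul_le_mul_of_nonneg_right (map_mul_le_mul ν _ _) (apply_nonneg ν _))
  rw [div_mul_eq_mul_div, le_div_iff₀ hpos]
  linarith

lemma summable_absMatrix_pow_of_algebraNorm (M : Matrix (Fin n) (Fin n) 𝕜)
    (ν : AlgebraNorm 𝕜 (Matrix (Fin n) (Fin n) 𝕜)) (hν : ν (absMatrix M) < 1) :
    Summable fun k : ℕ => absMatrix M ^ k := by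
  refine Pi.summable.mpr fun p => Pi.summable.mpr fun q => ?_
  obtain ⟨C, hC⟩ := ν.exists_norm_entry_le p q
  -- The exponent starts at one because a submultiplicative norm need not give the identity norm
  -- one.
  have hpow : ∀ k : ℕ, ν (absMatrix M ^ (k + 1)) ≤ ν (absMatrix M) ^ (k + 1) := by
    intro k
    induction k with
    | zero => simp
    | succ k ih =>
      rw [pow_succ, pow_succ (ν _)]
      exact (map_mul_le_mul ν _ _).trans (mul_le_mul_of_nonneg_right ih (apply_nonneg ν _))
  rw [← summable_nat_add_iff 1]
  refine Summable.of_norm_bounded (g := fun k : ℕ => |C| * ν (absMatrix M) ^ (k + 1)) ?_ fun k => ?_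
  · exact ((summable_nat_add_iff 1).mpr
      (summable_geometric_of_lt_one (apply_nonneg ν _) hν)).mul_left _
  · refine (hC _).trans ?_
    exact mul_le_mul (le_abs_self C) (hpow k) (apply_nonneg ν _) (abs_nonneg _)

/-- The row sums of absolute values are bounded by the norm on `ℓ^∞`. -/
lemma sum_norm_le_normInftyInfty (M : Matrix (Fin n) (Fin n) 𝕜) (p : Fin n) :
    ∑ q, ‖M p q‖ ≤ normInftyInfty M := by
  classical
  -- The conjugate phases of row `p` form a vector in the unit ball on which the row attains its
  -- absolute sum.
  let x : Fin n → 𝕜 := fun q => if M p q = 0 then 0 else (starRingEnd 𝕜) (M p q) / (‖M p q‖ : 𝕜)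
  have hx : ‖x‖ ≤ 1 := by
    refine (pi_norm_le_iff_of_nonneg zero_le_one).mpr fun q => ?_
    by_cases h : M p q = 0
    · simp [x, h]
    · simp [x, h]
  have hMx : (M *ᵥ x) p = ((∑ q, ‖M p q‖ : ℝ) : 𝕜) := by
    simp only [Matrix.mulVec, dotProduct, RCLike.ofReal_sum]
    refine Finset.sum_congr rfl fun q _ => ?_
    by_cases h : M p q = 0
    · simp [x, h]
    · have hn : (‖M p q‖ : 𝕜) ≠ 0 := by simpa using h
      simp only [x, h, if_false]
      rw [mul_div_assoc', RCLike.mul_conj, sq, mul_div_assoc, div_self hn, mul_one]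
  calc ∑ q, ‖M p q‖ = ‖(M *ᵥ x) p‖ := by
        rw [hMx, RCLike.norm_ofReal, abs_of_nonneg (Finset.sum_nonneg fun _ _ => norm_nonneg _)]
    _ ≤ ‖M *ᵥ x‖ := norm_le_pi_norm _ _
    _ = ‖LinearMap.toContinuousLinearMap (Matrix.mulVecLin M) x‖ := rfl
    _ ≤ normInftyInfty M * ‖x‖ := ContinuousLinearMap.le_opNorm _ _
    _ ≤ normInftyInfty M * 1 := mul_le_mul_of_nonneg_left hx (norm_nonneg _)
    _ = normInftyInfty M := mul_one _

lemma norm_complexify (M : Matrix (Fin n) (Fin n) 𝕜) (p q : Fin n) :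
    ‖complexify M p q‖ = ‖M p q‖ := by
  simp [complexify]

/-- Each of the first two conditions gives entrywise summable powers of the delay matrix. -/
lemma summable_l1Norm_delayMatrix_pow (M : Matrix (Fin n) (Fin n) 𝕜) (τ : Fin n → ℝ≥0)
    (hM : normInftyInfty M < 1 ∨ Summable fun k : ℕ => absMatrix M ^ k) (p q : Fin n) :
    Summable fun k : ℕ => l1Norm ((delayMatrix (complexify M) τ ^ k) p q) := by
  rcases hM with hM | hM
  -- The first condition is the row sum criterion with `k₀ = 1`, since every entry of the delay
  -- matrix is a single exponential.
  · refine summable_l1Norm_pow _ zero_lt_one (fun p => ?_) p q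
    refine lt_of_le_of_lt ?_ hM
    refine le_trans (le_of_eq ?_) (sum_norm_le_normInftyInfty M p)
    simp [delayMatrix, norm_complexify]
  · refine Summable.of_nonneg_of_le (fun _ => l1Norm_nonneg _)
      (fun k => l1Norm_delayMatrix_pow_le _ τ k p q) ?_
    have h := (summable_absMatrix_pow_iff M).mp hM p q
    have hmap : (complexify M).map (fun z => ‖z‖) = M.map fun z => ‖z‖ := by
      ext i j
      exact norm_complexify M i j
    rwa [hmap]

end AbsMatrix

/-! ### The total variation of the inverse Laplace transform of an exponential polynomial -/

section LaplaceVariation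

open ExpPoly

/-- The measure `∑ c_d δ_d` with Laplace transform `∑ c_d e^{-sd}`. -/
def ExpPoly.toMeasure (a : ExpPoly) : ComplexMeasure ℝ≥0 :=
  ∑ d ∈ a.coeff.support, VectorMeasure.dirac d (a.coeff d)

lemma ExpPoly.variation_toMeasure_le (a : ExpPoly) :
    a.toMeasure.variation univ ≤ ENNReal.ofReal (l1Norm a) := by
  rw [l1Norm, ENNReal.ofReal_sum_of_nonneg fun _ _ => norm_nonneg _]
  refine (VectorMeasure.variation_finsetSum_le _ _ univ).trans (le_of_eq ?_)
  simp [Measure.finsetSum_apply, VectorMeasure.variation_dirac, ofReal_norm]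

lemma continuous_exp_neg_mul (s : ℂ) :
    Continuous fun t : ℝ≥0 => Complex.exp (-s * ((t : ℝ) : ℂ)) := by
  fun_prop

lemma norm_exp_neg_mul_le {s : ℂ} (hs : 0 ≤ s.re) (t : ℝ≥0) :
    ‖Complex.exp (-s * ((t : ℝ) : ℂ))‖ ≤ 1 := by
  rw [Complex.norm_exp, Real.exp_le_one_iff]
  simpa using mul_nonneg hs t.2

lemma integrable_exp_neg_mul {μ : ComplexMeasure ℝ≥0} (hμ : μ.variation univ ≠ ⊤) {s : ℂ}
    (hs : 0 ≤ s.re) : μ.Integrable fun t : ℝ≥0 => Complex.exp (-s * ((t : ℝ) : ℂ)) := by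
  have : IsFiniteMeasure μ.variation := ⟨lt_top_iff_ne_top.mpr hμ⟩
  exact Integrable.of_bound (continuous_exp_neg_mul s).aestronglyMeasurable 1
    (ae_of_all _ (norm_exp_neg_mul_le hs))

lemma ExpPoly.isInverseLaplace_toMeasure (a : ExpPoly) :
    IsInverseLaplace a.toMeasure (fun s => eval s a) := by
  refine ⟨(a.variation_toMeasure_le.trans_lt ENNReal.ofReal_lt_top).ne, 0, le_rfl, fun s hs => ?_⟩
  rw [ExpPoly.toMeasure, VectorMeasure.integral_finsetSum_vectorMeasure]
  · refine Eq.trans (Finset.sum_congr rfl fun d _ => ?_) (eval_apply s a).symm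
    rw [VectorMeasure.integral_dirac, ContinuousLinearMap.mul_apply', mul_comm]
  · intro d _
    exact integrable_exp_neg_mul (measure_ne_top _ _) hs.le

/-- The pairing used in the integral is only declared real bilinear, so complex homogeneity has to
be taken from commutativity of multiplication. -/
lemma ComplexMeasure.integral_const_mul (μ : ComplexMeasure ℝ≥0) (c : ℂ) (f : ℝ≥0 → ℂ) :
    μ.integral (fun t => c * f t) (ContinuousLinearMap.mul ℝ ℂ) =
      c * μ.integral f (ContinuousLinearMap.mul ℝ ℂ) := by
  rw [VectorMeasure.integral_eq_setToFun, VectorMeasure.integral_eq_setToFun]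
  refine setToFun_smul (𝕜 := ℂ) _ (fun c s x => ?_) c f
  simp [VectorMeasure.transpose, mul_left_comm]

/-- A bounded continuous test function interpolating prescribed values of modulus at most one at
finitely many points, which is approximated by combinations of `e^{-kt}` with `k` large. -/
lemma exists_exp_sum_near (F : Finset ℝ≥0) (w : ℝ≥0 → ℂ) (hw : ∀ d, ‖w d‖ ≤ 1) (N : ℕ) {ε : ℝ}
    (hε : 0 < ε) :
    ∃ P : Polynomial ℂ, (∀ t : ℝ≥0, ‖∑ k ∈ P.support, P.coeff k *
        Complex.exp (-((N + k : ℕ) : ℂ) * ((t : ℝ) : ℂ))‖ ≤ 1 + ε) ∧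
      ∀ d ∈ F, ‖∑ k ∈ P.support, P.coeff k *
        Complex.exp (-((N + k : ℕ) : ℂ) * ((d : ℝ) : ℂ)) - w d‖ ≤ ε := by
  classical
  -- interpolation at the points `e^{-d}`
  let S : Set ℝ := (fun d : ℝ≥0 => Real.exp (-(d : ℝ))) '' F
  have hSfin : S.Finite := F.finite_toSet.image _
  have : Finite S := hSfin
  have : DiscreteTopology S := inferInstance
  let f₀ : C(S, ℂ) := ⟨fun x => w (Real.toNNReal (-Real.log x)), continuous_of_discreteTopology⟩
  have := Metric.instTietzeExtensionClosedBall ℂ (0 : ℂ) zero_lt_one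
  -- The Tietze extension stays in the closed unit disc, which is what keeps the supremum close to
  -- one.
  obtain ⟨g, hg_mem, hg⟩ := f₀.exists_forall_mem_restrict_eq hSfin.isClosed
    (t := Metric.closedBall 0 1) (fun x => by simpa [f₀] using hw _)
  have hgw : ∀ d ∈ F, g (Real.exp (-(d : ℝ))) = w d := by
    intro d hd
    have := DFunLike.congr_fun hg ⟨Real.exp (-(d : ℝ)), d, hd, rfl⟩
    simpa [f₀] using this
  -- The sum of the exponents dominates each of them and also covers the empty set.
  obtain ⟨δ, hδ, hδF⟩ : ∃ δ : ℝ, 0 < δ ∧ ∀ d ∈ F, δ ≤ Real.exp (-(d : ℝ)) := by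
    refine ⟨Real.exp (-((∑ d ∈ F, d : ℝ≥0) : ℝ)), Real.exp_pos _, fun d hd => ?_⟩
    rw [Real.exp_le_exp, neg_le_neg_iff, NNReal.coe_le_coe]
    exact Finset.single_le_sum (f := fun d : ℝ≥0 => d) (fun _ _ => zero_le) hd
  -- With `x = e^{-t}`, sums of `e^{-kt}` over `k ≥ N` are `x^N P(x)`, so `P` should approximate `g
  -- / x^N`. Truncating the denominator at `δ` keeps the quotient continuous at zero and does not
  -- change it at the nodes; elsewhere `x ≤ max x δ` still gives `|x^N χ| ≤ 1`.
  let χ : ℝ → ℂ := fun x => g x / ((max x δ : ℝ) : ℂ) ^ N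
  have hmax : ∀ x : ℝ, 0 < max x δ := fun x => lt_max_of_lt_right hδ
  have hχ : Continuous χ := by
    refine Continuous.div (map_continuous g) (by fun_prop) fun x => ?_
    exact pow_ne_zero _ (Complex.ofReal_ne_zero.mpr (hmax x).ne')
  obtain ⟨p, hp⟩ := exists_polynomial_near_of_continuousOn 0 1 (fun x => (χ x).re)
    (Complex.continuous_re.comp hχ).continuousOn (ε / 2) (half_pos hε)
  obtain ⟨q, hq⟩ := exists_polynomial_near_of_continuousOn 0 1 (fun x => (χ x).im)
    (Complex.continuous_im.comp hχ).continuousOn (ε / 2) (half_pos hε)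
  let P : Polynomial ℂ := p.map (algebraMap ℝ ℂ) + Polynomial.C Complex.I * q.map (algebraMap ℝ ℂ)
  have hP : ∀ x ∈ Icc (0 : ℝ) 1, ‖P.eval (x : ℂ) - χ x‖ ≤ ε := by
    intro x hx
    have h1 : P.eval (x : ℂ) - χ x =
        ((p.eval x - (χ x).re : ℝ) : ℂ) + Complex.I * ((q.eval x - (χ x).im : ℝ) : ℂ) := by
      have hpe : (p.map (algebraMap ℝ ℂ)).eval (x : ℂ) = ((p.eval x : ℝ) : ℂ) :=
        Polynomial.eval_map_apply (algebraMap ℝ ℂ) x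
      have hqe : (q.map (algebraMap ℝ ℂ)).eval (x : ℂ) = ((q.eval x : ℝ) : ℂ) :=
        Polynomial.eval_map_apply (algebraMap ℝ ℂ) x
      conv_lhs => rw [← Complex.re_add_im (χ x)]
      simp only [P, Polynomial.eval_add, Polynomial.eval_mul, Polynomial.eval_C, hpe, hqe]
      push_cast
      ring
    rw [h1]
    refine (norm_add_le _ _).trans ?_
    rw [norm_mul, Complex.norm_I, one_mul, Complex.norm_real, Complex.norm_real]
    have := (hp x hx).le
    have := (hq x hx).le
    rw [Real.norm_eq_abs, Real.norm_eq_abs]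
    linarith
  have hsum : ∀ t : ℝ≥0, ∑ k ∈ P.support, P.coeff k *
      Complex.exp (-((N + k : ℕ) : ℂ) * ((t : ℝ) : ℂ)) =
      ((Real.exp (-(t : ℝ)) : ℝ) : ℂ) ^ N * P.eval ((Real.exp (-(t : ℝ)) : ℝ) : ℂ) := by
    intro t
    rw [Polynomial.eval_eq_sum, Polynomial.sum, Finset.mul_sum]
    refine Finset.sum_congr rfl fun k _ => ?_
    have : Complex.exp (-((N + k : ℕ) : ℂ) * ((t : ℝ) : ℂ)) =
        ((Real.exp (-(t : ℝ)) : ℝ) : ℂ) ^ (N + k) := by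
      rw [Complex.ofReal_exp, ← Complex.exp_nat_mul]
      congr 1
      push_cast
      ring
    rw [this, pow_add]
    ring
  have hx01 : ∀ t : ℝ≥0, Real.exp (-(t : ℝ)) ∈ Icc (0 : ℝ) 1 := fun t =>
    ⟨(Real.exp_pos _).le, Real.exp_le_one_iff.mpr (by simp)⟩
  have hdiff : ∀ t : ℝ≥0, ‖((Real.exp (-(t : ℝ)) : ℝ) : ℂ) ^ N *
      P.eval ((Real.exp (-(t : ℝ)) : ℝ) : ℂ) -
      ((Real.exp (-(t : ℝ)) : ℝ) : ℂ) ^ N * χ (Real.exp (-(t : ℝ)))‖ ≤ ε := by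
    intro t
    rw [← mul_sub, norm_mul, norm_pow, Complex.norm_real, Real.norm_eq_abs,
      abs_of_nonneg (hx01 t).1]
    calc _ ≤ 1 * ε := mul_le_mul (pow_le_one₀ (hx01 t).1 (hx01 t).2) (hP _ (hx01 t))
          (norm_nonneg _) zero_le_one
      _ = ε := one_mul ε
  refine ⟨P, fun t => ?_, fun d hd => ?_⟩
  · rw [hsum]
    have hb : ‖((Real.exp (-(t : ℝ)) : ℝ) : ℂ) ^ N * χ (Real.exp (-(t : ℝ)))‖ ≤ 1 := by
      set x := Real.exp (-(t : ℝ)) with hx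
      have hgx : ‖g x‖ ≤ 1 := by simpa using hg_mem x
      have hx0 : 0 ≤ x := (hx01 t).1
      simp only [χ, norm_mul, norm_div, norm_pow, Complex.norm_real, Real.norm_eq_abs]
      rw [abs_of_nonneg hx0, abs_of_pos (hmax x), mul_div_assoc']
      refine div_le_one_of_le₀ ?_ (pow_nonneg (hmax x).le _)
      calc x ^ N * ‖g x‖ ≤ (max x δ) ^ N * 1 :=
            mul_le_mul (pow_le_pow_left₀ hx0 (le_max_left _ _) N) hgx (norm_nonneg _)
              (pow_nonneg (hmax x).le _)
        _ = _ := mul_one _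
    have := norm_le_norm_add_norm_sub' (((Real.exp (-(t : ℝ)) : ℝ) : ℂ) ^ N *
      P.eval ((Real.exp (-(t : ℝ)) : ℝ) : ℂ))
      (((Real.exp (-(t : ℝ)) : ℝ) : ℂ) ^ N * χ (Real.exp (-(t : ℝ))))
    linarith [hdiff t]
  · rw [hsum]
    have h2 : ((Real.exp (-(d : ℝ)) : ℝ) : ℂ) ^ N * χ (Real.exp (-(d : ℝ))) = w d := by
      have hne : ((Real.exp (-(d : ℝ)) : ℝ) : ℂ) ^ N ≠ 0 :=
        pow_ne_zero _ (Complex.ofReal_ne_zero.mpr (Real.exp_pos _).ne')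
      simp only [χ]
      rw [max_eq_left (hδF d hd), hgw d hd, mul_div_cancel₀ _ hne]
    rw [← h2]
    exact hdiff d

/-- Duality, without using uniqueness of Laplace transforms. A test function close to the conjugate
phases of the coefficients at the exponents, and bounded by `1 + ε`, almost recovers the `ℓ¹` norm.
Choosing it as a combination of exponentials with integer rates beyond the abscissa `α` makes its
integral computable from the transform alone. -/
lemma l1Norm_le_variation (a : ExpPoly) {μ : ComplexMeasure ℝ≥0}
    (hμ : IsInverseLaplace μ fun s => eval s a) :
    ENNReal.ofReal (l1Norm a) ≤ μ.variation univ := by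
  obtain ⟨hfin, α, hα, hL⟩ := hμ
  have : IsFiniteMeasure μ.variation := ⟨lt_top_iff_ne_top.mpr hfin⟩
  rw [ENNReal.ofReal_le_iff_le_toReal hfin]
  set V := (μ.variation univ).toReal with hV
  obtain ⟨N, hN⟩ := exists_nat_gt α
  let w : ℝ≥0 → ℂ := fun d =>
    if a.coeff d = 0 then 0 else (starRingEnd ℂ) (a.coeff d) / (‖a.coeff d‖ : ℂ)
  have hw : ∀ d, ‖w d‖ ≤ 1 := by
    intro d
    by_cases h : a.coeff d = 0 <;> simp [w, h]
  have haw : ∀ d, a.coeff d * w d = (‖a.coeff d‖ : ℂ) := by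
    intro d
    by_cases h : a.coeff d = 0
    · simp [w, h]
    · have hn : (‖a.coeff d‖ : ℂ) ≠ 0 := by simpa using h
      simp only [w, h, if_false]
      rw [mul_div_assoc', Complex.mul_conj, Complex.normSq_eq_norm_sq]
      push_cast
      rw [sq, mul_div_assoc, div_self hn, mul_one]
  have key : ∀ ε > 0, l1Norm a ≤ (1 + ε) * V + l1Norm a * ε := by
    intro ε hε
    obtain ⟨P, hP1, hP2⟩ := exists_exp_sum_near a.coeff.support w hw N hε
    set φ : ℝ≥0 → ℂ := fun t => ∑ k ∈ P.support, P.coeff k *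
        Complex.exp (-((N + k : ℕ) : ℂ) * ((t : ℝ) : ℂ)) with hφ
    -- All rates are at least `N > α`, so the transform identity applies term by term.
    have h_int : μ.integral φ (ContinuousLinearMap.mul ℝ ℂ) =
        ∑ d ∈ a.coeff.support, a.coeff d * φ d := by
      rw [hφ, VectorMeasure.integral_finsetSum]
      · simp_rw [ComplexMeasure.integral_const_mul, Finset.mul_sum]
        rw [Finset.sum_comm]
        refine Finset.sum_congr rfl fun k _ => ?_
        rw [hL _ (by
          rw [Complex.natCast_re]
          refine hN.trans_le ?_
          exact_mod_cast Nat.le_add_right N k)]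
        simp only [eval_apply, Finset.mul_sum]
        refine Finset.sum_congr rfl fun d _ => ?_
        ring
      · intro k _
        have := integrable_exp_neg_mul hfin (s := ((N + k : ℕ) : ℂ)) (by
          rw [Complex.natCast_re]; positivity)
        exact this.smul (P.coeff k)
    have hle : ‖μ.integral φ (ContinuousLinearMap.mul ℝ ℂ)‖ ≤ (1 + ε) * V := by
      refine (VectorMeasure.norm_integral_le_of_norm_le_const (C := 1 + ε)
        (ae_of_all _ hP1)).trans ?_
      rw [ContinuousLinearMap.opNorm_mul, mul_one]
      rfl
    have hdiff : ‖((l1Norm a : ℝ) : ℂ) - ∑ d ∈ a.coeff.support, a.coeff d * φ d‖ ≤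
        l1Norm a * ε := by
      rw [l1Norm, Complex.ofReal_sum, ← Finset.sum_sub_distrib, Finset.sum_mul]
      refine (norm_sum_le _ _).trans (Finset.sum_le_sum fun d hd => ?_)
      rw [← haw, ← mul_sub, norm_mul, norm_sub_rev]
      exact mul_le_mul_of_nonneg_left (hP2 d hd) (norm_nonneg _)
    have h1 : ‖((l1Norm a : ℝ) : ℂ)‖ = l1Norm a := by
      rw [Complex.norm_real, Real.norm_eq_abs, abs_of_nonneg (l1Norm_nonneg a)]
    have h2 := norm_le_norm_add_norm_sub' ((l1Norm a : ℝ) : ℂ)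
      (∑ d ∈ a.coeff.support, a.coeff d * φ d)
    rw [h1] at h2
    rw [h_int] at hle
    linarith
  have hlim : Tendsto (fun ε : ℝ => (1 + ε) * V + l1Norm a * ε) (𝓝[>] 0) (𝓝 V) := by
    have : Tendsto (fun ε : ℝ => (1 + ε) * V + l1Norm a * ε) (𝓝 0)
        (𝓝 ((1 + 0) * V + l1Norm a * 0)) := (by fun_prop : Continuous _).tendsto 0
    simpa using this.mono_left nhdsWithin_le_nhds
  exact ge_of_tendsto hlim (eventually_nhdsWithin_of_forall fun ε hε => key ε hε)

/-- The discrete measure with masses `c_d` attains the infimum; the lower bound holds for every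
representing measure. -/
theorem laplaceVariation_eval (a : ExpPoly) :
    laplaceVariation (fun s => eval s a) = ENNReal.ofReal (l1Norm a) := by
  refine le_antisymm ?_ (le_iInf₂ fun μ hμ => l1Norm_le_variation a hμ)
  exact (iInf₂_le a.toMeasure a.isInverseLaplace_toMeasure).trans a.variation_toMeasure_le

end LaplaceVariation

/-! ### The positive and negative parts of `P₁^D` -/

namespace HBCS

section SignMatrix

variable {𝕜 : Type*} [RCLike 𝕜] {n : ℕ}

lemma P1D_mul_self (m : ℕ) : P1D 𝕜 n m * P1D 𝕜 n m = 1 := by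
  rw [P1D, Matrix.diagonal_mul_diagonal, ← Matrix.diagonal_one]
  congr 1
  ext i
  split_ifs <;> simp

lemma P1D_inv (m : ℕ) : (P1D 𝕜 n m)⁻¹ = P1D 𝕜 n m := Matrix.inv_eq_right_inv (P1D_mul_self m)

lemma isSelfAdjoint_P1D (m : ℕ) : IsSelfAdjoint (P1D 𝕜 n m) := by
  rw [isSelfAdjoint_iff, Matrix.star_eq_conjTranspose, P1D, Matrix.diagonal_conjTranspose]
  congr 1
  ext i
  simp only [Pi.star_apply]
  split_ifs <;> simp

/-- The matrix is an involution, so `(x - P)(x + P) = x² - 1` inverts `x - P` whenever `x² ≠ 1`. -/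
lemma spectrum_P1D_subset (m : ℕ) : spectrum ℝ (P1D 𝕜 n m) ⊆ {1, -1} := by
  intro x hx
  by_contra hne
  have hx2 : x ^ 2 - 1 ≠ 0 := fun h => hne (sq_eq_one_iff.mp (sub_eq_zero.mp h))
  refine hx ?_
  have h1 : (algebraMap ℝ (Matrix (Fin n) (Fin n) 𝕜) x - P1D 𝕜 n m) *
      ((x ^ 2 - 1)⁻¹ • (algebraMap ℝ (Matrix (Fin n) (Fin n) 𝕜) x + P1D 𝕜 n m)) = 1 := by
    have h2 : (algebraMap ℝ (Matrix (Fin n) (Fin n) 𝕜) x - P1D 𝕜 n m) *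
        (algebraMap ℝ (Matrix (Fin n) (Fin n) 𝕜) x + P1D 𝕜 n m) =
        (x ^ 2 - 1) • (1 : Matrix (Fin n) (Fin n) 𝕜) := by
      simp only [Algebra.algebraMap_eq_smul_one, mul_add, sub_mul, P1D_mul_self, smul_mul_assoc,
        mul_smul_comm, one_mul, mul_one]
      module
    rw [mul_smul_comm, h2, smul_smul, inv_mul_cancel₀ hx2, one_smul]
  exact IsUnit.of_mul_eq_one _ h1

/-- On a two-point spectrum every function agrees with an affine one, for which the functional
calculus is explicit. -/
lemma cfc_P1D (m : ℕ) (f : ℝ → ℝ) :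
    cfc f (P1D 𝕜 n m) =
      Matrix.diagonal fun i : Fin n => if (i : ℕ) < m then ((f 1 : ℝ) : 𝕜) else ((f (-1) : ℝ) : 𝕜) := by
  have h : EqOn f (fun x => (f 1 - f (-1)) / 2 * x + (f 1 + f (-1)) / 2)
      (spectrum ℝ (P1D 𝕜 n m)) := by
    intro x hx
    rcases spectrum_P1D_subset m hx with rfl | rfl
    · ring
    · ring
  rw [cfc_congr h, cfc_add_const _ _ _ (by fun_prop) (isSelfAdjoint_P1D m),
    cfc_const_mul_id _ _ (isSelfAdjoint_P1D m)]
  ext i j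
  rw [Matrix.add_apply, Matrix.smul_apply, Matrix.algebraMap_matrix_apply, P1D]
  rcases eq_or_ne i j with rfl | hij
  · simp only [Matrix.diagonal_apply_eq, if_true]
    split_ifs
    · simp only [RCLike.real_smul_eq_coe_mul, RCLike.algebraMap_eq_ofReal]
      push_cast
      ring
    · simp only [RCLike.real_smul_eq_coe_mul, RCLike.algebraMap_eq_ofReal]
      push_cast
      ring
  · simp [hij]

end SignMatrix

namespace Diagonalisation

variable {𝕜 : Type*} [RCLike 𝕜] {n : ℕ} {sys : HBCS 𝕜 n} (D : sys.Diagonalisation)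

lemma system_Qplus :
    D.system.Qplus = Matrix.diagonal fun i : Fin n => if (i : ℕ) < D.m then (1 : 𝕜) else 0 := by
  simp only [Qplus, system]
  rw [cfc_P1D]
  simp [Real.sqrt_eq_zero_of_nonpos]

lemma system_Qminus :
    D.system.Qminus = Matrix.diagonal fun i : Fin n => if (i : ℕ) < D.m then (0 : 𝕜) else 1 := by
  simp only [Qminus, system]
  rw [cfc_P1D]
  simp [Real.sqrt_eq_zero_of_nonpos]

/-! ### Travel times along the characteristics -/

/-- The sign of the `i`-th diagonal entry of `P₁^D`. -/
def sgn (i : Fin n) : ℝ := if (i : ℕ) < D.m then 1 else -1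

lemma sgn_mul_self (i : Fin n) : D.sgn i * D.sgn i = 1 := by
  unfold sgn
  split_ifs <;> norm_num

lemma P1D_eq_diagonal_sgn : P1D 𝕜 n D.m = Matrix.diagonal fun i => ((D.sgn i : ℝ) : 𝕜) := by
  rw [P1D]
  congr 1
  ext i
  unfold sgn
  split_ifs <;> simp

/-- The reciprocal propagation speed `1 / hᵢ`, extended continuously from `[a, b]` to `ℝ`. -/
def slowness (i : Fin n) (ξ : ℝ) : ℝ := (D.h (max sys.a (min sys.b ξ)) i)⁻¹

lemma clip_mem (sys : HBCS 𝕜 n) (ξ : ℝ) : max sys.a (min sys.b ξ) ∈ Icc sys.a sys.b :=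
  ⟨le_max_left _ _, max_le sys.hab.le (min_le_left _ _)⟩

lemma clip_eq (sys : HBCS 𝕜 n) {ξ : ℝ} (hξ : ξ ∈ Icc sys.a sys.b) :
    max sys.a (min sys.b ξ) = ξ := by
  rw [min_eq_right hξ.2, max_eq_right hξ.1]

lemma slowness_eq (i : Fin n) {ξ : ℝ} (hξ : ξ ∈ Icc sys.a sys.b) :
    D.slowness i ξ = (D.h ξ i)⁻¹ := by
  rw [slowness, clip_eq sys hξ]

lemma slowness_pos (i : Fin n) (ξ : ℝ) : 0 < D.slowness i ξ :=
  inv_pos.mpr (D.h_pos _ (clip_mem sys ξ) i)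

lemma continuous_slowness (i : Fin n) : Continuous (D.slowness i) := by
  refine Continuous.inv₀ ?_ fun ξ => (D.h_pos _ (clip_mem sys ξ) i).ne'
  exact (D.h_contDiff i).continuousOn.comp_continuous (by fun_prop) (clip_mem sys)

/-- The time in which the `i`-th component travels through `[a, b]`. -/
def travelTime (i : Fin n) : ℝ := ∫ ζ in sys.a..sys.b, D.slowness i ζ

lemma travelTime_pos (i : Fin n) : 0 < D.travelTime i :=
  intervalIntegral.intervalIntegral_pos_of_pos ((D.continuous_slowness i).intervalIntegrable _ _)
    (D.slowness_pos i) sys.hab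

/-- The travel times as nonnegative delays. -/
def delays (i : Fin n) : ℝ≥0 := ⟨D.travelTime i, (D.travelTime_pos i).le⟩

@[simp] lemma coe_delays (i : Fin n) : (D.delays i : ℝ) = D.travelTime i := rfl

end Diagonalisation

end HBCS

/-! ### The fundamental solution of the diagonalised system -/

lemma hasDerivAt_exp_integral {κ : ℝ → ℂ} (hκ : Continuous κ) (a ζ : ℝ) :
    HasDerivAt (fun ζ => Complex.exp (∫ τ in a..ζ, κ τ))
      (κ ζ * Complex.exp (∫ τ in a..ζ, κ τ)) ζ := by
  have := (hκ.integral_hasStrictDerivAt a ζ).hasDerivAt.cexp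
  rwa [mul_comm] at this

/-- The linear Volterra equation `f(ζ) = c + ∫_a^ζ κ f` has only the solution `c e^{∫ κ}`. -/
lemma eq_mul_exp_integral_of_volterra {a b : ℝ} (hab : a ≤ b) {κ f : ℝ → ℂ} {c : ℂ}
    (hκ : Continuous κ) (hf : ContinuousOn f (Icc a b))
    (h : ∀ ζ ∈ Icc a b, f ζ = c + ∫ τ in a..ζ, κ τ * f τ) :
    f b = c * Complex.exp (∫ τ in a..b, κ τ) := by
  have hmem : ∀ ζ, max a (min b ζ) ∈ Icc a b := fun ζ =>
    ⟨le_max_left _ _, max_le hab (min_le_left _ _)⟩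
  have hclip : ∀ ζ ∈ Icc a b, max a (min b ζ) = ζ := fun ζ hζ => by
    rw [min_eq_right hζ.2, max_eq_right hζ.1]
  -- Clipping the argument makes the integrand continuous on the whole line, so its primitive has
  -- two-sided derivatives also at the endpoints.
  let g : ℝ → ℂ := fun ζ => κ ζ * f (max a (min b ζ))
  have hg : Continuous g := hκ.mul (hf.comp_continuous (by fun_prop) hmem)
  let F : ℝ → ℂ := fun ζ => c + ∫ τ in a..ζ, g τ
  have hF : ∀ ζ, HasDerivAt F (g ζ) ζ := fun ζ =>
    (hg.integral_hasStrictDerivAt a ζ).hasDerivAt.const_add c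
  have hFf : ∀ ζ ∈ Icc a b, F ζ = f ζ := by
    intro ζ hζ
    have : ∫ τ in a..ζ, g τ = ∫ τ in a..ζ, κ τ * f τ := by
      refine intervalIntegral.integral_congr fun τ hτ => ?_
      rw [uIcc_of_le hζ.1] at hτ
      simp only [g, hclip τ ⟨hτ.1, hτ.2.trans hζ.2⟩]
    rw [h ζ hζ, ← this]
  -- The integrating factor `e^{-∫ κ}` turns the solution into a constant.
  have hderiv : ∀ ζ ∈ Icc a b, HasDerivAt
      (fun ζ => F ζ * Complex.exp (∫ τ in a..ζ, -κ τ)) 0 ζ := by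
    intro ζ hζ
    refine ((hF ζ).mul (hasDerivAt_exp_integral hκ.neg a ζ)).congr_deriv ?_
    rw [hFf ζ hζ]
    simp only [g, hclip ζ hζ, Pi.neg_apply]
    ring
  have hconst := constant_of_has_deriv_right_zero
    (f := fun ζ => F ζ * Complex.exp (∫ τ in a..ζ, -κ τ))
    (fun ζ hζ => (hderiv ζ hζ).continuousAt.continuousWithinAt)
    (fun ζ hζ => (hderiv ζ (Ico_subset_Icc_self hζ)).hasDerivWithinAt) b ⟨hab, le_rfl⟩
  simp only [F, intervalIntegral.integral_same, add_zero, Complex.exp_zero, mul_one,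
    intervalIntegral.integral_neg, Complex.exp_neg] at hconst
  rw [← hFf b ⟨hab, le_rfl⟩]
  rwa [mul_inv_eq_iff_eq_mul₀ (Complex.exp_ne_zero _)] at hconst

namespace HBCS.Diagonalisation

variable {𝕜 : Type*} [RCLike 𝕜] {n : ℕ} {sys : HBCS 𝕜 n} (D : sys.Diagonalisation)

lemma complexify_diagonal_ofReal (d : Fin n → ℝ) :
    complexify (Matrix.diagonal fun i => ((d i : ℝ) : 𝕜)) =
      Matrix.diagonal fun i => ((d i : ℝ) : ℂ) := by
  rw [complexify, Matrix.diagonal_map (map_zero _)]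
  simp

lemma integrand_fundamentalSolution {ξ : ℝ} (hξ : ξ ∈ Icc sys.a sys.b) (h0 : D.P0D ξ = 0) (s : ℂ)
    (A : Matrix (Fin n) (Fin n) ℂ) (i j : Fin n) :
    (-(complexify D.system.P1)⁻¹ * (complexify (D.system.P0 ξ) -
        s • (complexify (D.system.H ξ))⁻¹) * A) i j =
      s * (D.sgn i : ℂ) * (D.slowness i ξ : ℂ) * A i j := by
  have h1 : (complexify D.system.P1)⁻¹ = Matrix.diagonal fun i => ((D.sgn i : ℝ) : ℂ) := by
    simp only [system]
    rw [D.P1D_eq_diagonal_sgn, complexify_diagonal_ofReal]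
    refine Matrix.inv_eq_right_inv ?_
    rw [Matrix.diagonal_mul_diagonal, ← Matrix.diagonal_one]
    congr 1
    ext i
    exact_mod_cast D.sgn_mul_self i
  have h2 : (complexify (D.system.H ξ))⁻¹ = Matrix.diagonal fun i => ((D.slowness i ξ : ℝ) : ℂ) := by
    simp only [system]
    rw [complexify_diagonal_ofReal]
    refine Matrix.inv_eq_right_inv ?_
    rw [Matrix.diagonal_mul_diagonal, ← Matrix.diagonal_one]
    congr 1
    ext i
    rw [D.slowness_eq i hξ]
    have := (D.h_pos ξ hξ i).ne'
    exact_mod_cast mul_inv_cancel₀ this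
  have h3 : complexify (D.system.P0 ξ) = 0 := by
    simp only [system]
    rw [h0]
    ext i j
    simp [complexify]
  rw [h1, h2, h3]
  rw [zero_sub, neg_mul_neg, ← Matrix.diagonal_smul, Matrix.diagonal_mul_diagonal,
    Matrix.diagonal_mul]
  simp only [Pi.smul_apply, smul_eq_mul]
  ring

lemma isFundamentalSolution_iff (hP0 : ∀ᵐ ξ ∂sys.vol, D.P0D ξ = 0)
    (s : ℂ) (Ψ : ℝ → Matrix (Fin n) (Fin n) ℂ) :
    D.system.IsFundamentalSolution s Ψ ↔ ContinuousOn Ψ (Icc sys.a sys.b) ∧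
      ∀ ζ ∈ Icc sys.a sys.b, ∀ i j, Ψ ζ i j = (1 : Matrix (Fin n) (Fin n) ℂ) i j +
        ∫ τ in sys.a..ζ, s * (D.sgn i : ℂ) * (D.slowness i τ : ℂ) * Ψ τ i j := by
  refine and_congr Iff.rfl (forall₂_congr fun ζ hζ => forall₂_congr fun i j => ?_)
  have : ∫ τ in sys.a..ζ, (-(complexify D.system.P1)⁻¹ * (complexify (D.system.P0 τ) -
        s • (complexify (D.system.H τ))⁻¹) * Ψ τ) i j =
      ∫ τ in sys.a..ζ, s * (D.sgn i : ℂ) * (D.slowness i τ : ℂ) * Ψ τ i j := by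
    refine intervalIntegral.integral_congr_ae ?_
    rw [ae_restrict_iff' measurableSet_Icc] at hP0
    filter_upwards [hP0] with τ hτ hmem
    rw [uIoc_of_le (show sys.a ≤ ζ from hζ.1)] at hmem
    have hτ' : τ ∈ Icc sys.a sys.b := ⟨hmem.1.le, hmem.2.trans hζ.2⟩
    exact D.integrand_fundamentalSolution hτ' (hτ hτ') s _ i j
  change (Ψ ζ i j = _ + ∫ τ in sys.a..ζ, _) ↔ _
  rw [this]

/-- The fundamental solution is obtained by choice, so two things are needed: the explicit diagonal
exponential shows that the choice satisfies the equation, and Volterra uniqueness in each entry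
identifies its value at `b`. -/
lemma fundamentalSolution_system_apply (hP0 : ∀ᵐ ξ ∂sys.vol, D.P0D ξ = 0)
    (s : ℂ) :
    D.system.fundamentalSolution s sys.b =
      Matrix.diagonal fun i => Complex.exp (s * (D.sgn i : ℂ) * (D.travelTime i : ℂ)) := by
  have hκ : ∀ i, Continuous fun τ => s * (D.sgn i : ℂ) * (D.slowness i τ : ℂ) := fun i =>
    continuous_const.mul (Complex.continuous_ofReal.comp (D.continuous_slowness i))
  have h_int : ∀ i, ∫ τ in sys.a..sys.b, s * (D.sgn i : ℂ) * (D.slowness i τ : ℂ) =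
      s * (D.sgn i : ℂ) * (D.travelTime i : ℂ) := fun i => by
    rw [intervalIntegral.integral_const_mul, intervalIntegral.integral_ofReal, travelTime]
  have hex : D.system.IsFundamentalSolution s (D.system.fundamentalSolution s) := by
    refine Classical.epsilon_spec (p := D.system.IsFundamentalSolution s)
      ⟨fun ζ => Matrix.diagonal fun i =>
        Complex.exp (∫ τ in sys.a..ζ, s * (D.sgn i : ℂ) * (D.slowness i τ : ℂ)), ?_⟩
    rw [D.isFundamentalSolution_iff hP0]
    constructor
    · refine Continuous.continuousOn ?_
      refine Continuous.matrix_diagonal (continuous_pi fun i => ?_)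
      exact continuous_iff_continuousAt.mpr fun ζ => (hasDerivAt_exp_integral (hκ i) _ ζ).continuousAt
    · intro ζ hζ i j
      rcases eq_or_ne i j with rfl | hij
      · simp only [Matrix.diagonal_apply_eq, Matrix.one_apply_eq]
        rw [intervalIntegral.integral_eq_sub_of_hasDerivAt
          (fun x _ => hasDerivAt_exp_integral (hκ i) sys.a x)]
        · simp
        · refine Continuous.intervalIntegrable ((hκ i).mul ?_) _ _
          exact continuous_iff_continuousAt.mpr fun ζ =>
            (hasDerivAt_exp_integral (hκ i) _ ζ).continuousAt
      · simp [hij]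
  rw [D.isFundamentalSolution_iff hP0] at hex
  ext i j
  have hcont : ContinuousOn (fun ζ => D.system.fundamentalSolution s ζ i j) (Icc sys.a sys.b) :=
    (continuous_apply_apply i j).comp_continuousOn hex.1
  rw [eq_mul_exp_integral_of_volterra sys.hab.le (hκ i) hcont (fun ζ hζ => hex.2 ζ hζ i j), h_int]
  rcases eq_or_ne i j with rfl | hij
  · simp
  · simp [hij]

/-- For `i < m` the entry `e^{sτ}` of the fundamental solution sits in `V` and is inverted; for the
other indices `e^{-sτ}` sits in the numerator. Both give the same decaying exponential. -/
lemma system_U (hP0 : ∀ᵐ ξ ∂sys.vol, D.P0D ξ = 0)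
    (s : ℂ) :
    D.system.U s = Matrix.diagonal fun i => Complex.exp (-s * ((D.delays i : ℝ) : ℂ)) := by
  have hp : complexify D.system.Qplus =
      Matrix.diagonal fun i : Fin n => if (i : ℕ) < D.m then (1 : ℂ) else 0 := by
    rw [D.system_Qplus, complexify, Matrix.diagonal_map (map_zero _)]
    congr 1
    ext i
    split_ifs <;> simp
  have hm : complexify D.system.Qminus =
      Matrix.diagonal fun i : Fin n => if (i : ℕ) < D.m then (0 : ℂ) else 1 := by
    rw [D.system_Qminus, complexify, Matrix.diagonal_map (map_zero _)]
    congr 1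
    ext i
    split_ifs <;> simp
  have hΨ := D.fundamentalSolution_system_apply hP0 s
  have hV : (D.system.V s)⁻¹ = Matrix.diagonal fun i : Fin n =>
      if (i : ℕ) < D.m then Complex.exp (-s * ((D.delays i : ℝ) : ℂ)) else 1 := by
    refine Matrix.inv_eq_right_inv ?_
    rw [V, hp, hm]
    change (_ + _ * D.system.fundamentalSolution s sys.b) * _ = 1
    rw [hΨ, Matrix.diagonal_mul_diagonal, Matrix.diagonal_add, Matrix.diagonal_mul_diagonal,
      ← Matrix.diagonal_one]
    congr 1
    ext i
    by_cases hi : (i : ℕ) < D.m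
    · simp [hi, sgn, ← Complex.exp_add]
    · simp [hi]
  rw [U, hV, hp, hm]
  change (_ + _ * D.system.fundamentalSolution s sys.b) * _ = _
  rw [hΨ, Matrix.diagonal_mul_diagonal, Matrix.diagonal_add, Matrix.diagonal_mul_diagonal]
  congr 1
  ext i
  by_cases hi : (i : ℕ) < D.m
  · simp [hi]
  · simp [hi, sgn]

theorem powVariation_system (hP0 : ∀ᵐ ξ ∂sys.vol, D.P0D ξ = 0)
    (M : Matrix (Fin n) (Fin n) 𝕜) (k : ℕ) (p q : Fin n) :
    D.system.powVariation M k p q =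
      ENNReal.ofReal (ExpPoly.l1Norm ((delayMatrix (complexify M) D.delays ^ k) p q)) := by
  rw [powVariation, ← laplaceVariation_eval]
  congr 1
  ext s
  rw [map_eval_delayMatrix_pow, D.system_U hP0]

/-- Each of the three conditions gives entrywise summable powers of the delay matrix. -/
lemma summable_l1Norm_of_conditions (hP0 : ∀ᵐ ξ ∂sys.vol, D.P0D ξ = 0)
    (M : Matrix (Fin n) (Fin n) 𝕜)
    (hM : normInftyInfty M < 1 ∨ (Summable fun k : ℕ => absMatrix M ^ k) ∨
      (∃ k₀ : ℕ, 0 < k₀ ∧ ∀ p, ∑ r, D.system.powVariation M k₀ p r < 1)) (p q : Fin n) :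
    Summable fun k : ℕ => ExpPoly.l1Norm ((delayMatrix (complexify M) D.delays ^ k) p q) := by
  rcases hM with hM | hM | ⟨k₀, hk₀, hM⟩
  · exact summable_l1Norm_delayMatrix_pow M _ (Or.inl hM) p q
  · exact summable_l1Norm_delayMatrix_pow M _ (Or.inr hM) p q
  · refine summable_l1Norm_pow _ hk₀ (fun p => ?_) p q
    have := hM p
    simp_rw [D.powVariation_system hP0] at this
    rw [← ENNReal.ofReal_sum_of_nonneg fun _ _ => ExpPoly.l1Norm_nonneg _,
      ← ENNReal.ofReal_one, ENNReal.ofReal_lt_ofReal_iff zero_lt_one] at this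
    exact this

end HBCS.Diagonalisation

/-! ### Strongly continuous semigroups -/

section Semigroup

variable {𝕜 : Type*} [RCLike 𝕜] {X : Type*} [NormedAddCommGroup X] [NormedSpace 𝕜 X]
  {T : ℝ≥0 → X →L[𝕜] X}

lemma tendsto_coe_nhdsGT_zero : Tendsto (fun t : ℝ≥0 => (t : ℝ)) (𝓝[>] 0) (𝓝[>] 0) := by
  refine tendsto_nhdsWithin_iff.mpr ⟨?_, ?_⟩
  · exact (NNReal.continuous_coe.tendsto' 0 0 rfl).mono_left nhdsWithin_le_nhds
  · exact eventually_nhdsWithin_of_forall fun t ht => by simpa using ht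

lemma tendsto_toNNReal_nhdsGT_zero : Tendsto Real.toNNReal (𝓝[>] 0) (𝓝[>] 0) := by
  refine tendsto_nhdsWithin_iff.mpr ⟨?_, ?_⟩
  · exact (continuous_real_toNNReal.tendsto' 0 0 (by simp)).mono_left nhdsWithin_le_nhds
  · exact eventually_nhdsWithin_of_forall fun t ht => by simpa using ht

/-- The domain of the generator of a strongly continuous semigroup is dense. -/
lemma dense_domain_of_semigroup [NormedSpace ℝ X] [IsScalarTower ℝ 𝕜 X] [CompleteSpace X]
    (h0 : T 0 = 1)
    (hadd : ∀ s t, T (s + t) = T s * T t) (hcont : ∀ x, Continuous fun t => T t x)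
    {G : X → X → Prop}
    (hG : ∀ x y, G x y ↔
      Tendsto (fun t : ℝ≥0 => ((t : ℝ) : 𝕜)⁻¹ • (T t x - x)) (𝓝[>] 0) (𝓝 y)) :
    Dense {x | ∃ y, G x y} := by
  intro x
  let f : ℝ → X := fun s => T s.toNNReal x
  have hf : Continuous f := (hcont x).comp continuous_real_toNNReal
  have hf0 : f 0 = x := by simp [f, h0]
  have hprim : ∀ u, HasDerivAt (fun u => ∫ s in (0 : ℝ)..u, f s) (f u) u := fun u =>
    (hf.integral_hasStrictDerivAt 0 u).hasDerivAt
  -- Averages of an orbit lie in the domain because `T r` merely shifts the window of integration,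
  -- so the difference quotient involves only the two ends; the averages tend to `x` as the window
  -- shrinks.
  have hmem : ∀ t : ℝ, 0 < t → t⁻¹ • ∫ s in (0 : ℝ)..t, f s ∈ {x | ∃ y, G x y} := by
    intro t ht
    refine ⟨t⁻¹ • (f t - f 0), (hG _ _).mpr ?_⟩
    have hshift : ∀ r : ℝ≥0, T r (∫ s in (0 : ℝ)..t, f s) = ∫ s in (r : ℝ)..t + r, f s := by
      intro r
      rw [← ContinuousLinearMap.intervalIntegral_comp_comm _ (hf.intervalIntegrable _ _)]
      have h1 : ∫ s in (0 : ℝ)..t, T r (f s) = ∫ s in (0 : ℝ)..t, f (s + r) := by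
        refine intervalIntegral.integral_congr fun s hs => ?_
        rw [uIcc_of_le ht.le] at hs
        have : (s + r).toNNReal = r + s.toNNReal := by
          rw [Real.toNNReal_add hs.1 r.coe_nonneg, Real.toNNReal_coe, add_comm]
        simp only [f]
        rw [this, hadd]
        rfl
      rw [h1, intervalIntegral.integral_comp_add_right, zero_add]
    have hder : HasDerivAt (fun u => (∫ s in (0 : ℝ)..t + u, f s) - ∫ s in (0 : ℝ)..u, f s)
        (f t - f 0) 0 := by
      refine HasDerivAt.sub ?_ (hprim 0)
      have h1 := hprim (t + 0)
      rw [add_zero] at h1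
      exact HasDerivAt.comp_const_add (f := fun u => ∫ s in (0 : ℝ)..u, f s) t 0
        (by rwa [add_zero])
    have hs := (hasDerivAt_iff_tendsto_slope.mp hder).mono_left
      (nhdsWithin_mono 0 (fun u (hu : 0 < u) => hu.ne'))
    refine ((hs.comp tendsto_coe_nhdsGT_zero).const_smul t⁻¹).congr fun r => ?_
    have h2 : ∫ s in (r : ℝ)..t + r, f s =
        (∫ s in (0 : ℝ)..t + r, f s) - ∫ s in (0 : ℝ)..r, f s :=
      (intervalIntegral.integral_interval_sub_left (hf.intervalIntegrable _ _)
        (hf.intervalIntegrable _ _)).symm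
    have h3 : T r (t⁻¹ • ∫ s in (0 : ℝ)..t, f s) = t⁻¹ • T r (∫ s in (0 : ℝ)..t, f s) := by
      have := (T r).map_smul ((t⁻¹ : ℝ) : 𝕜) (∫ s in (0 : ℝ)..t, f s)
      rwa [← RCLike.real_smul_eq_coe_smul, ← RCLike.real_smul_eq_coe_smul] at this
    rw [h3, hshift, h2, ← smul_sub, ← RCLike.ofReal_inv, ← RCLike.real_smul_eq_coe_smul,
      smul_comm]
    simp [slope_def_module]
  have hlim : Tendsto (fun t : ℝ => t⁻¹ • ∫ s in (0 : ℝ)..t, f s) (𝓝[>] 0) (𝓝 x) := by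
    have hs := (hasDerivAt_iff_tendsto_slope.mp (hprim 0)).mono_left
      (nhdsWithin_mono 0 (fun u (hu : 0 < u) => hu.ne'))
    rw [hf0] at hs
    refine hs.congr fun t => ?_
    simp [slope_def_module]
  exact mem_closure_of_tendsto hlim (eventually_nhdsWithin_of_forall hmem)

lemma semigroup_domain_invariant (hadd : ∀ s t, T (s + t) = T s * T t) {G : X → X → Prop}
    (hG : ∀ x y, G x y ↔
      Tendsto (fun t : ℝ≥0 => ((t : ℝ) : 𝕜)⁻¹ • (T t x - x)) (𝓝[>] 0) (𝓝 y))
    {x z : X} (hxz : G x z) (t : ℝ≥0) : G (T t x) (T t z) := by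
  rw [hG] at hxz ⊢
  refine (((T t).continuous.tendsto z).comp hxz).congr fun r => ?_
  have : T r (T t x) = T t (T r x) := by
    rw [← mul_apply_eq_comp, ← mul_apply_eq_comp, ← hadd, ← hadd, add_comm]
  simp [this]

/-- The generator is a one-sided limit at zero, and the semigroup law moves it to time `t`. Right
derivatives suffice for the constancy argument in which this is used. -/
lemma semigroup_hasDerivWithinAt [NormedSpace ℝ X] [IsScalarTower ℝ 𝕜 X]
    (hadd : ∀ s t, T (s + t) = T s * T t) {G : X → X → Prop}
    (hG : ∀ x y, G x y ↔
      Tendsto (fun t : ℝ≥0 => ((t : ℝ) : 𝕜)⁻¹ • (T t x - x)) (𝓝[>] 0) (𝓝 y))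
    {x z : X} (hxz : G x z) {t : ℝ} (ht : 0 ≤ t) :
    HasDerivWithinAt (fun s : ℝ => T s.toNNReal x) (T t.toNNReal z) (Ici t) t := by
  have h1 := (hG _ _).mp (semigroup_domain_invariant hadd hG hxz t.toNNReal)
  rw [← hasDerivWithinAt_Ioi_iff_Ici, hasDerivWithinAt_iff_tendsto_slope]
  have hIoi : Ioi t \ {t} = Ioi t := by simp
  rw [hIoi]
  have hsub : Tendsto (fun s : ℝ => s - t) (𝓝[>] t) (𝓝[>] 0) := by
    refine tendsto_nhdsWithin_iff.mpr ⟨?_, ?_⟩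
    · exact ((continuous_id.sub continuous_const).tendsto' t 0 (by simp)).mono_left
        nhdsWithin_le_nhds
    · exact eventually_nhdsWithin_of_forall fun s hs => by simpa using hs
  refine (h1.comp (tendsto_toNNReal_nhdsGT_zero.comp hsub)).congr' ?_
  refine eventually_nhdsWithin_of_forall fun s (hs : t < s) => ?_
  have h2 : s.toNNReal = (s - t).toNNReal + t.toNNReal := by
    rw [← Real.toNNReal_add (sub_nonneg.mpr hs.le) ht, sub_add_cancel]
  simp only [Function.comp_apply, slope_def_module]
  rw [Real.coe_toNNReal _ (sub_nonneg.mpr hs.le), h2, hadd, ← RCLike.ofReal_inv,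
    ← RCLike.real_smul_eq_coe_smul]
  rfl

end Semigroup

/-! ### Products of primitives -/

section ProductRule

variable {𝕜 : Type*} [RCLike 𝕜]

/-- Exchanging the order of integration over a triangle. -/
lemma integral_mul_primitive {a b : ℝ} (hab : a ≤ b) {f g : ℝ → 𝕜}
    (hf : IntervalIntegrable f volume a b) (hg : IntervalIntegrable g volume a b) :
    ∫ ξ in a..b, f ξ * ∫ ζ in a..ξ, g ζ = ∫ ζ in a..b, (∫ ξ in ζ..b, f ξ) * g ζ := by
  rw [intervalIntegrable_iff_integrableOn_Ioc_of_le hab] at hf hg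
  let μ := volume.restrict (Ioc a b)
  -- Fubini for the kernel `f(ξ) g(ζ)` cut off to the triangle `ζ ≤ ξ`.
  let k : ℝ → ℝ → 𝕜 := fun ξ ζ => {p : ℝ × ℝ | p.2 ≤ p.1}.indicator (fun p => f p.1 * g p.2) (ξ, ζ)
  have hk : Integrable (Function.uncurry k) (μ.prod μ) := by
    refine (Integrable.mul_prod hf hg).indicator ?_
    exact measurableSet_le measurable_snd measurable_fst
  have h1 : ∀ ξ ∈ Ioc a b, ∫ ζ, k ξ ζ ∂μ = f ξ * ∫ ζ in a..ξ, g ζ := by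
    intro ξ hξ
    have hk1 : (fun ζ => k ξ ζ) = (Iic ξ).indicator fun ζ => f ξ * g ζ := by
      ext ζ
      simp [k, indicator_apply]
    rw [hk1, integral_indicator measurableSet_Iic, Measure.restrict_restrict measurableSet_Iic,
      integral_const_mul, intervalIntegral.integral_of_le hξ.1.le]
    congr 3
    ext ζ
    simp only [mem_inter_iff, mem_Iic, mem_Ioc]
    exact ⟨fun h => ⟨h.2.1, h.1⟩, fun h => ⟨h.2, h.1, h.2.trans hξ.2⟩⟩
  have h2 : ∀ ζ ∈ Ioc a b, ∫ ξ, k ξ ζ ∂μ = (∫ ξ in ζ..b, f ξ) * g ζ := by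
    intro ζ hζ
    have hk2 : (fun ξ => k ξ ζ) = (Ici ζ).indicator fun ξ => f ξ * g ζ := by
      ext ξ
      simp [k, indicator_apply]
    rw [hk2, integral_indicator measurableSet_Ici, Measure.restrict_restrict measurableSet_Ici,
      integral_mul_const, intervalIntegral.integral_of_le hζ.2, ← integral_Icc_eq_integral_Ioc]
    congr 3
    ext ξ
    simp only [mem_inter_iff, mem_Ici, mem_Ioc, mem_Icc]
    exact ⟨fun h => ⟨h.1, h.2.2⟩, fun h => ⟨h.1, hζ.1.trans_le h.1, h.2⟩⟩
  rw [intervalIntegral.integral_of_le hab, intervalIntegral.integral_of_le hab,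
    ← setIntegral_congr_fun measurableSet_Ioc h1, ← setIntegral_congr_fun measurableSet_Ioc h2]
  exact integral_integral_swap hk

/-- The product rule for a `C¹` function and a primitive of an integrable function. -/
lemma mul_primitive_eq {a b : ℝ} {c c' v w : ℝ → 𝕜}
    (hc : ∀ ξ ∈ Icc a b, HasDerivWithinAt c (c' ξ) (Icc a b) ξ)
    (hc' : ContinuousOn c' (Icc a b)) (hw : IntervalIntegrable w volume a b)
    (hv : ∀ ξ ∈ Icc a b, v ξ = v a + ∫ ζ in a..ξ, w ζ) {x : ℝ} (hx : x ∈ Icc a b) :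
    IntervalIntegrable (fun ξ => c' ξ * v ξ + c ξ * w ξ) volume a x ∧
      c x * v x = c a * v a + ∫ ξ in a..x, (c' ξ * v ξ + c ξ * w ξ) := by
  have hsub : Icc a x ⊆ Icc a b := Icc_subset_Icc_right hx.2
  have hcc : ContinuousOn c (Icc a b) := fun ξ hξ => (hc ξ hξ).continuousWithinAt
  have hwx : IntervalIntegrable w volume a x :=
    hw.mono_set (by rw [uIcc_of_le hx.1, uIcc_of_le (hx.1.trans hx.2)]; exact hsub)
  have hc'x : IntervalIntegrable c' volume a x :=
    (hc'.mono hsub).intervalIntegrable_of_Icc hx.1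
  have hftc : ∀ ζ ∈ Icc a x, ∫ ξ in ζ..x, c' ξ = c x - c ζ := by
    intro ζ hζ
    refine intervalIntegral.integral_eq_sub_of_hasDerivAt_of_le hζ.2
      (hcc.mono (Icc_subset_Icc hζ.1 hx.2)) (fun ξ hξ => ?_) ?_
    · exact (hc ξ ⟨hζ.1.trans hξ.1.le, hξ.2.le.trans hx.2⟩).hasDerivAt
        (Icc_mem_nhds (hζ.1.trans_lt hξ.1) (hξ.2.trans_le hx.2))
    · exact (hc'.mono (Icc_subset_Icc hζ.1 hx.2)).intervalIntegrable_of_Icc hζ.2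
  have hprimc : ContinuousOn (fun ξ => ∫ ζ in a..ξ, w ζ) (Icc a x) := by
    have := intervalIntegral.continuousOn_primitive_interval' hwx (left_mem_uIcc)
    rwa [uIcc_of_le hx.1] at this
  have hvc : ContinuousOn v (Icc a x) :=
    (continuousOn_const.add hprimc).congr fun ξ hξ => hv ξ (hsub hξ)
  have hi1 : IntervalIntegrable (fun ξ => c' ξ * v ξ) volume a x :=
    ((hc'.mono hsub).mul hvc).intervalIntegrable_of_Icc hx.1
  have hi2 : IntervalIntegrable (fun ξ => c ξ * w ξ) volume a x :=
    hwx.continuousOn_mul (by rw [uIcc_of_le hx.1]; exact hcc.mono hsub)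
  have hi3 : IntervalIntegrable (fun ξ => c' ξ * ∫ ζ in a..ξ, w ζ) volume a x :=
    ((hc'.mono hsub).mul hprimc).intervalIntegrable_of_Icc hx.1
  -- Since `v` is only a primitive of an integrable function, it is expanded into its primitive and
  -- the order of integration exchanged, so that the derivative is integrated only for the `C¹`
  -- factor.
  have e1 : ∫ ξ in a..x, c' ξ * v ξ = (c x - c a) * v a +
      ∫ ζ in a..x, (c x - c ζ) * w ζ := by
    have : ∫ ξ in a..x, c' ξ * v ξ =
        ∫ ξ in a..x, (c' ξ * v a + c' ξ * ∫ ζ in a..ξ, w ζ) := by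
      refine intervalIntegral.integral_congr fun ξ hξ => ?_
      rw [uIcc_of_le hx.1] at hξ
      rw [hv ξ (hsub hξ), mul_add]
    rw [this, intervalIntegral.integral_add (hc'x.mul_const _) hi3,
      intervalIntegral.integral_mul_const, hftc a ⟨le_rfl, hx.1⟩,
      integral_mul_primitive hx.1 hc'x hwx]
    congr 1
    refine intervalIntegral.integral_congr fun ζ hζ => ?_
    rw [uIcc_of_le hx.1] at hζ
    rw [hftc ζ hζ]
  have e2 : ∫ ζ in a..x, (c x - c ζ) * w ζ =
      c x * (∫ ζ in a..x, w ζ) - ∫ ζ in a..x, c ζ * w ζ := by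
    rw [← intervalIntegral.integral_const_mul,
      ← intervalIntegral.integral_sub (hwx.const_mul _) hi2]
    simp_rw [sub_mul]
  refine ⟨hi1.add hi2, ?_⟩
  rw [intervalIntegral.integral_add hi1 hi2, e1, e2, hv x hx]
  ring

end ProductRule

/-! ### Derivatives of matrix valued functions -/

section MatrixDeriv

variable {𝕜 : Type*} [RCLike 𝕜] {n : ℕ}

lemma DifferentiableWithinAt.matrix_det {A : ℝ → Matrix (Fin n) (Fin n) 𝕜} {s : Set ℝ} {ξ : ℝ}
    (hA : ∀ i j, DifferentiableWithinAt ℝ (fun ζ => A ζ i j) s ξ) :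
    DifferentiableWithinAt ℝ (fun ζ => (A ζ).det) s ξ := by
  simp_rw [Matrix.det_apply]
  refine DifferentiableWithinAt.fun_sum fun σ _ => ?_
  refine DifferentiableWithinAt.const_smul ?_ _
  exact DifferentiableWithinAt.fun_finsetProd fun i _ => hA _ _

lemma DifferentiableWithinAt.matrix_inv {A : ℝ → Matrix (Fin n) (Fin n) 𝕜} {s : Set ℝ} {ξ : ℝ}
    (hA : ∀ i j, DifferentiableWithinAt ℝ (fun ζ => A ζ i j) s ξ) (hu : IsUnit (A ξ))
    (i j : Fin n) : DifferentiableWithinAt ℝ (fun ζ => (A ζ)⁻¹ i j) s ξ := by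
  simp_rw [Matrix.inv_def, Ring.inverse_eq_inv', Matrix.smul_apply, smul_eq_mul,
    Matrix.adjugate_apply]
  have hdet : (A ξ).det ≠ 0 := ((Matrix.isUnit_iff_isUnit_det _).mp hu).ne_zero
  refine ((DifferentiableWithinAt.matrix_det hA).inv hdet).mul
    (DifferentiableWithinAt.matrix_det fun k l => ?_)
  simp_rw [Matrix.updateRow_apply]
  split_ifs
  · exact differentiableWithinAt_const _
  · exact hA k l

lemma HasDerivWithinAt.matrix_mul {A B : ℝ → Matrix (Fin n) (Fin n) 𝕜}
    {A' B' : Matrix (Fin n) (Fin n) 𝕜} {s : Set ℝ} {ξ : ℝ}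
    (hA : ∀ i j, HasDerivWithinAt (fun ζ => A ζ i j) (A' i j) s ξ)
    (hB : ∀ i j, HasDerivWithinAt (fun ζ => B ζ i j) (B' i j) s ξ) (i j : Fin n) :
    HasDerivWithinAt (fun ζ => (A ζ * B ζ) i j) ((A' * B ξ + A ξ * B') i j) s ξ := by
  simp_rw [Matrix.add_apply, Matrix.mul_apply, ← Finset.sum_add_distrib]
  exact HasDerivWithinAt.fun_sum fun k _ => (hA i k).mul (hB k j)

end MatrixDeriv

namespace HBCS.Diagonalisation

variable {𝕜 : Type*} [RCLike 𝕜] {n : ℕ} {sys : HBCS 𝕜 n} (D : sys.Diagonalisation)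

/-- The entrywise derivative of `S` on `[a, b]`. -/
def derivS (ξ : ℝ) : Matrix (Fin n) (Fin n) 𝕜 :=
  Matrix.of fun i j => derivWithin (fun ζ => D.S ζ i j) (Icc sys.a sys.b) ξ

lemma hasDerivWithinAt_S {ξ : ℝ} (hξ : ξ ∈ Icc sys.a sys.b) (i j : Fin n) :
    HasDerivWithinAt (fun ζ => D.S ζ i j) (D.derivS ξ i j) (Icc sys.a sys.b) ξ :=
  ((D.S_contDiff i j).differentiableOn one_ne_zero ξ hξ).hasDerivWithinAt

lemma continuousOn_S (i j : Fin n) : ContinuousOn (fun ζ => D.S ζ i j) (Icc sys.a sys.b) :=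
  (D.S_contDiff i j).continuousOn

lemma continuousOn_derivS (i j : Fin n) :
    ContinuousOn (fun ζ => D.derivS ζ i j) (Icc sys.a sys.b) :=
  (D.S_contDiff i j).continuousOn_derivWithin (uniqueDiffOn_Icc sys.hab) le_rfl

lemma hasDerivWithinAt_S_inv {ξ : ℝ} (hξ : ξ ∈ Icc sys.a sys.b) (i j : Fin n) :
    HasDerivWithinAt (fun ζ => (D.S ζ)⁻¹ i j) (D.derivSInv ξ i j) (Icc sys.a sys.b) ξ :=
  (DifferentiableWithinAt.matrix_inv
    (fun i j => (D.hasDerivWithinAt_S hξ i j).differentiableWithinAt) (D.S_unit ξ hξ) i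
    j).hasDerivWithinAt

lemma S_inv_mul {ξ : ℝ} (hξ : ξ ∈ Icc sys.a sys.b) : (D.S ξ)⁻¹ * D.S ξ = 1 :=
  Matrix.nonsing_inv_mul _ ((Matrix.isUnit_iff_isUnit_det _).mp (D.S_unit ξ hξ))

lemma S_mul_inv {ξ : ℝ} (hξ : ξ ∈ Icc sys.a sys.b) : D.S ξ * (D.S ξ)⁻¹ = 1 :=
  Matrix.mul_nonsing_inv _ ((Matrix.isUnit_iff_isUnit_det _).mp (D.S_unit ξ hξ))

lemma derivSInv_mul_add {ξ : ℝ} (hξ : ξ ∈ Icc sys.a sys.b) :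
    D.derivSInv ξ * D.S ξ + (D.S ξ)⁻¹ * D.derivS ξ = 0 := by
  ext i j
  have h1 := HasDerivWithinAt.matrix_mul (fun i j => D.hasDerivWithinAt_S_inv hξ i j)
    (fun i j => D.hasDerivWithinAt_S hξ i j) i j
  have h2 : HasDerivWithinAt (fun ζ => ((D.S ζ)⁻¹ * D.S ζ) i j) 0 (Icc sys.a sys.b) ξ := by
    refine (hasDerivWithinAt_const ξ (Icc sys.a sys.b)
      ((1 : Matrix (Fin n) (Fin n) 𝕜) i j)).congr (fun ζ hζ => ?_) ?_
    · rw [D.S_inv_mul hζ]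
    · rw [D.S_inv_mul hξ]
  exact (uniqueDiffOn_Icc sys.hab ξ hξ).eq_deriv _ h1 h2

/-- If `P₀^D` vanishes then `S' P₁ = S P₀`. -/
lemma derivS_mul_P1 (hP1 : IsUnit sys.P1) {ξ : ℝ} (hξ : ξ ∈ Icc sys.a sys.b) (h0 : D.P0D ξ = 0) :
    D.derivS ξ * sys.P1 = D.S ξ * sys.P0 ξ := by
  have hP1' : sys.P1⁻¹ * sys.P1 = 1 :=
    Matrix.nonsing_inv_mul _ ((Matrix.isUnit_iff_isUnit_det _).mp hP1)
  have h1 : D.S ξ * D.derivSInv ξ = -(D.S ξ * (sys.P0 ξ * sys.P1⁻¹ * (D.S ξ)⁻¹)) := by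
    have := congrArg (· * P1D 𝕜 n D.m) h0
    simp only [P0D, Matrix.mul_assoc, P1D_mul_self, Matrix.zero_mul, Matrix.mul_one] at this
    rw [Matrix.mul_add] at this
    rw [Matrix.mul_assoc]
    exact eq_neg_of_add_eq_zero_left this
  -- This is `(S⁻¹)' = -S⁻¹ S' S⁻¹` solved for `S'`.
  have h2 : D.derivS ξ = -(D.S ξ * D.derivSInv ξ * D.S ξ) := by
    have := congrArg (D.S ξ * ·) (D.derivSInv_mul_add hξ)
    simp only [Matrix.mul_add, ← Matrix.mul_assoc, D.S_mul_inv hξ, Matrix.one_mul,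
      Matrix.mul_zero] at this
    exact eq_neg_of_add_eq_zero_right this
  rw [h2, h1]
  simp only [neg_mul, neg_neg, Matrix.mul_assoc]
  rw [← Matrix.mul_assoc (D.S ξ)⁻¹, D.S_inv_mul hξ, Matrix.one_mul, hP1', Matrix.mul_one]

end HBCS.Diagonalisation

/-! ### Transport along the characteristics -/

namespace HBCS.Diagonalisation

variable {𝕜 : Type*} [RCLike 𝕜] {n : ℕ} {sys : HBCS 𝕜 n} (D : sys.Diagonalisation)

/-- The time which the `i`-th component needs to travel from `ξ` to the outflow boundary. -/
def arrival (i : Fin n) (ξ : ℝ) : ℝ :=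
  if (i : ℕ) < D.m then ∫ ζ in sys.a..ξ, D.slowness i ζ else ∫ ζ in ξ..sys.b, D.slowness i ζ

/-- The sign is such that `t + arrival` is constant along the characteristics of the `i`-th
component. -/
lemma hasDerivAt_arrival (i : Fin n) (ξ : ℝ) :
    HasDerivAt (D.arrival i) (D.sgn i * D.slowness i ξ) ξ := by
  unfold arrival sgn
  split_ifs
  · rw [one_mul]
    exact ((D.continuous_slowness i).integral_hasStrictDerivAt _ ξ).hasDerivAt
  · have h := ((D.continuous_slowness i).integral_hasStrictDerivAt sys.b ξ).hasDerivAt.neg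
    rw [neg_one_mul]
    refine h.congr_of_eventuallyEq (Eventually.of_forall fun ζ => ?_)
    exact intervalIntegral.integral_symm _ _

lemma continuous_arrival (i : Fin n) : Continuous (D.arrival i) :=
  continuous_iff_continuousAt.mpr fun ξ => (D.hasDerivAt_arrival i ξ).continuousAt

lemma arrival_nonneg (i : Fin n) {ξ : ℝ} (hξ : ξ ∈ Icc sys.a sys.b) : 0 ≤ D.arrival i ξ := by
  unfold arrival
  split_ifs
  · exact intervalIntegral.integral_nonneg hξ.1 fun ζ _ => (D.slowness_pos i ζ).le
  · exact intervalIntegral.integral_nonneg hξ.2 fun ζ _ => (D.slowness_pos i ζ).le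

lemma arrival_a (i : Fin n) :
    D.arrival i sys.a = if (i : ℕ) < D.m then 0 else D.travelTime i := by
  simp [arrival, travelTime]

lemma arrival_b (i : Fin n) :
    D.arrival i sys.b = if (i : ℕ) < D.m then D.travelTime i else 0 := by
  simp [arrival, travelTime]

/-- The `i`-th row of `S`, as a vector against which inner products are taken. -/
def row (i : Fin n) (ξ : ℝ) : EuclideanSpace 𝕜 (Fin n) :=
  WithLp.toLp 2 fun j => star (D.S ξ i j)

lemma inner_row (i : Fin n) (ξ : ℝ) (x : EuclideanSpace 𝕜 (Fin n)) :
    inner 𝕜 (D.row i ξ) x = (D.S ξ *ᵥ x.ofLp) i := by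
  simp [row, PiLp.inner_apply, Matrix.mulVec, dotProduct, mul_comm]

lemma continuousOn_row (i : Fin n) : ContinuousOn (D.row i) (Icc sys.a sys.b) := by
  refine (PiLp.continuous_toLp 2 _).comp_continuousOn (continuousOn_pi.mpr fun j => ?_)
  exact continuous_star.comp_continuousOn (D.continuousOn_S i j)

lemma memLp_of_continuousOn {f : ℝ → EuclideanSpace 𝕜 (Fin n)}
    (hf : ContinuousOn f (Icc sys.a sys.b)) : MemLp f 2 sys.vol := by
  obtain ⟨C, hC⟩ := isCompact_Icc.exists_bound_of_continuousOn hf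
  exact MemLp.of_bound (hf.aestronglyMeasurable measurableSet_Icc) C
    ((ae_restrict_iff' measurableSet_Icc).mpr (ae_of_all _ hC))

lemma memLp_smul_row (i : Fin n) {φ : ℝ → ℝ} (hφ : Continuous φ) :
    MemLp (fun ξ => φ ξ • D.row i ξ) 2 sys.vol :=
  memLp_of_continuousOn (hφ.continuousOn.smul (D.continuousOn_row i))

/-- The element `φ Sᵢ` of the state space which represents `x ↦ ∫ φ (S x)ᵢ`. -/
def testVec (i : Fin n) (φ : ℝ → ℝ) (hφ : Continuous φ) : sys.State :=
  (D.memLp_smul_row i hφ).toLp _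

lemma coeFn_testVec (i : Fin n) {φ : ℝ → ℝ} (hφ : Continuous φ) :
    D.testVec i φ hφ =ᵐ[sys.vol] fun ξ => φ ξ • D.row i ξ :=
  MemLp.coeFn_toLp _

lemma inner_testVec (i : Fin n) {φ : ℝ → ℝ} (hφ : Continuous φ) (x : sys.State) :
    inner 𝕜 (D.testVec i φ hφ) x = ∫ ξ, (φ ξ : 𝕜) * (D.S ξ *ᵥ (x ξ).ofLp) i ∂sys.vol := by
  rw [L2.inner_def]
  refine integral_congr_ae ?_
  filter_upwards [D.coeFn_testVec i hφ] with ξ hξ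
  rw [hξ, RCLike.real_smul_eq_coe_smul (K := 𝕜), inner_smul_left, RCLike.conj_ofReal, D.inner_row]

lemma integrable_testVec (i : Fin n) {φ : ℝ → ℝ} (hφ : Continuous φ) (x : sys.State) :
    Integrable (fun ξ => (φ ξ : 𝕜) * (D.S ξ *ᵥ (x ξ).ofLp) i) sys.vol := by
  refine (L2.integrable_inner (𝕜 := 𝕜) (D.testVec i φ hφ) x).congr ?_
  filter_upwards [D.coeFn_testVec i hφ] with ξ hξ
  rw [hξ, RCLike.real_smul_eq_coe_smul (K := 𝕜), inner_smul_left, RCLike.conj_ofReal, D.inner_row]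

/-- The family of test vectors obtained from `ψ` by translation along the characteristics. -/
def shiftVec (i : Fin n) (ψ : ℝ → ℝ) (hψ : Continuous ψ) (t : ℝ) : sys.State :=
  D.testVec i (fun ξ => ψ (t + D.arrival i ξ))
    (hψ.comp (continuous_const.add (D.continuous_arrival i)))

lemma coeFn_shiftVec (i : Fin n) {ψ : ℝ → ℝ} (hψ : Continuous ψ) (t : ℝ) :
    D.shiftVec i ψ hψ t =ᵐ[sys.vol] fun ξ => ψ (t + D.arrival i ξ) • D.row i ξ :=
  D.coeFn_testVec i _

/-- Uniform continuity of `ψ'` controls the difference quotient uniformly in the shift, and the `L²`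
norm of the row of `S` turns this into convergence in the state space. -/
lemma hasDerivAt_shiftVec (i : Fin n) {ψ : ℝ → ℝ} (hψ : ContDiff ℝ 1 ψ)
    (hsupp : HasCompactSupport ψ) (t : ℝ) :
    HasDerivAt (D.shiftVec i ψ hψ.continuous)
      (D.shiftVec i (deriv ψ) (hψ.continuous_deriv le_rfl) t) t := by
  set R : sys.State := D.testVec i (fun _ => 1) continuous_const with hR
  have huc : UniformContinuous (deriv ψ) :=
    (hψ.continuous_deriv le_rfl).uniformContinuous_of_tendsto_cocompact
      (hsupp.deriv.is_zero_at_infty)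
  rw [hasDerivAt_iff_isLittleO, Asymptotics.isLittleO_iff]
  intro ε hε
  -- Adding one to the norm avoids division by zero.
  have hε' : 0 < ε / (‖R‖ + 1) := by positivity
  obtain ⟨δ, hδ, hδψ⟩ := Metric.uniformContinuous_iff.mp huc _ hε'
  filter_upwards [Metric.ball_mem_nhds t hδ] with s hs
  have hscal : ∀ r : ℝ, ‖ψ (s + r) - ψ (t + r) - (s - t) * deriv ψ (t + r)‖ ≤
      ε / (‖R‖ + 1) * ‖s - t‖ := by
    intro r
    have hd : ∀ y ∈ segment ℝ t s, HasDerivWithinAt (fun y => ψ (y + r) - y * deriv ψ (t + r))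
        (deriv ψ (y + r) - deriv ψ (t + r)) (segment ℝ t s) y := by
      intro y _
      have h1 : HasDerivAt (fun y => ψ (y + r)) (deriv ψ (y + r)) y :=
        HasDerivAt.comp_add_const y r
          ((hψ.differentiable one_ne_zero).differentiableAt.hasDerivAt)
      have h2 : HasDerivAt (fun y => y * deriv ψ (t + r)) (1 * deriv ψ (t + r)) y :=
        (hasDerivAt_id y).mul_const _
      rw [one_mul] at h2
      exact (h1.sub h2).hasDerivWithinAt
    have hb : ∀ y ∈ segment ℝ t s, ‖deriv ψ (y + r) - deriv ψ (t + r)‖ ≤ ε / (‖R‖ + 1) := by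
      intro y hy
      rw [← dist_eq_norm]
      refine (hδψ ?_).le
      rw [dist_add_right]
      have hball : segment ℝ t s ⊆ Metric.ball t δ :=
        (convex_ball t δ).segment_subset (Metric.mem_ball_self hδ) hs
      exact hball hy
    have := (convex_segment t s).norm_image_sub_le_of_norm_hasDerivWithin_le hd hb
      (left_mem_segment ℝ t s) (right_mem_segment ℝ t s)
    refine le_trans (le_of_eq ?_) this
    congr 1
    ring
  have hnorm : ‖D.shiftVec i ψ hψ.continuous s - D.shiftVec i ψ hψ.continuous t -
      (s - t) • D.shiftVec i (deriv ψ) (hψ.continuous_deriv le_rfl) t‖ ≤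
      ε / (‖R‖ + 1) * ‖s - t‖ * ‖R‖ := by
    refine Lp.norm_le_mul_norm_of_ae_le_mul ?_
    filter_upwards [Lp.coeFn_sub (D.shiftVec i ψ hψ.continuous s -
        D.shiftVec i ψ hψ.continuous t)
        ((s - t) • D.shiftVec i (deriv ψ) (hψ.continuous_deriv le_rfl) t),
      Lp.coeFn_sub (D.shiftVec i ψ hψ.continuous s) (D.shiftVec i ψ hψ.continuous t),
      Lp.coeFn_smul (s - t) (D.shiftVec i (deriv ψ) (hψ.continuous_deriv le_rfl) t),
      D.coeFn_shiftVec i hψ.continuous s, D.coeFn_shiftVec i hψ.continuous t,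
      D.coeFn_shiftVec i (hψ.continuous_deriv le_rfl) t,
      D.coeFn_testVec i (continuous_const : Continuous fun _ => (1 : ℝ))]
      with ξ h1 h2 h3 h4 h5 h6 h7
    rw [h1, Pi.sub_apply, h2, Pi.sub_apply, h3, Pi.smul_apply, hR, h7, h4, h5,
      h6, one_smul, smul_smul, ← sub_smul, ← sub_smul, norm_smul]
    exact mul_le_mul_of_nonneg_right (hscal _) (norm_nonneg _)
  refine hnorm.trans ?_
  calc ε / (‖R‖ + 1) * ‖s - t‖ * ‖R‖ = ε * ‖s - t‖ * (‖R‖ / (‖R‖ + 1)) := by ring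
    _ ≤ ε * ‖s - t‖ * 1 := by
        refine mul_le_mul_of_nonneg_left ?_ (by positivity)
        exact div_le_one_of_le₀ (by linarith) (by positivity)
    _ = ε * ‖s - t‖ := mul_one _

/-- The effort variable `v^D = P₁^D S P₁ v` of the diagonalised system. -/
def effort (v : ℝ → EuclideanSpace 𝕜 (Fin n)) (ξ : ℝ) : Fin n → 𝕜 :=
  P1D 𝕜 n D.m *ᵥ (D.S ξ *ᵥ (sys.P1 *ᵥ (v ξ).ofLp))

/-- The components of the effort at the boundary through which they enter. -/
def inflow (v : ℝ → EuclideanSpace 𝕜 (Fin n)) (i : Fin n) : 𝕜 :=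
  if (i : ℕ) < D.m then D.effort v sys.b i else D.effort v sys.a i

/-- The components of the effort at the boundary through which they leave. -/
def outflow (v : ℝ → EuclideanSpace 𝕜 (Fin n)) (i : Fin n) : 𝕜 :=
  if (i : ℕ) < D.m then D.effort v sys.a i else D.effort v sys.b i

lemma effort_apply (v : ℝ → EuclideanSpace 𝕜 (Fin n)) (ξ : ℝ) (i : Fin n) :
    D.effort v ξ i = (D.sgn i : 𝕜) * (D.S ξ *ᵥ (sys.P1 *ᵥ (v ξ).ofLp)) i := by
  rw [effort, D.P1D_eq_diagonal_sgn, Matrix.mulVec_diagonal]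

lemma intervalIntegrable_S_mulVec (x : sys.State) (i : Fin n) :
    IntervalIntegrable (fun ξ => (D.S ξ *ᵥ (x ξ).ofLp) i) volume sys.a sys.b := by
  rw [intervalIntegrable_iff_integrableOn_Icc_of_le sys.hab.le]
  have := D.integrable_testVec i (continuous_const : Continuous fun _ => (1 : ℝ)) x
  simpa [IntegrableOn] using this

/-- `(S x)ᵢ` in terms of `(S P₁ v)ᵢ`. -/
lemma S_mulVec_state {x z : sys.State} {v : ℝ → EuclideanSpace 𝕜 (Fin n)}
    (hev : sys.Evolution x z v) (i : Fin n) :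
    ∀ᵐ ξ ∂sys.vol, (D.S ξ *ᵥ (x ξ).ofLp) i =
      ((D.sgn i * D.slowness i ξ : ℝ) : 𝕜) * (D.S ξ *ᵥ (sys.P1 *ᵥ (v ξ).ofLp)) i := by
  obtain ⟨w, -, hx, -⟩ := hev
  have hmem : ∀ᵐ ξ ∂sys.vol, ξ ∈ Icc sys.a sys.b := ae_restrict_mem measurableSet_Icc
  filter_upwards [hx, D.eq, hmem] with ξ hv heq hξ
  have h1 : D.S ξ * (sys.P1 * sys.H ξ) =
      P1D 𝕜 n D.m * Matrix.diagonal (fun i => (D.h ξ i : 𝕜)) * D.S ξ := by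
    rw [heq]
    simp only [← Matrix.mul_assoc]
    rw [D.S_mul_inv hξ, Matrix.one_mul]
  have hh : ((D.h ξ i : ℝ) : 𝕜) ≠ 0 := by exact_mod_cast (D.h_pos ξ hξ i).ne'
  have hs : ((D.sgn i : ℝ) : 𝕜) * ((D.sgn i : ℝ) : 𝕜) = 1 := by exact_mod_cast D.sgn_mul_self i
  rw [hv, Matrix.mulVec_mulVec, Matrix.mulVec_mulVec, Matrix.mul_assoc, h1,
    D.P1D_eq_diagonal_sgn, Matrix.diagonal_mul_diagonal, ← Matrix.mulVec_mulVec,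
    Matrix.mulVec_diagonal, D.slowness_eq i hξ]
  push_cast
  calc (D.S ξ *ᵥ (x ξ).ofLp) i
      = ((D.sgn i : 𝕜) * (D.sgn i : 𝕜)) * ((D.h ξ i : 𝕜)⁻¹ * (D.h ξ i : 𝕜)) *
        (D.S ξ *ᵥ (x ξ).ofLp) i := by rw [hs, inv_mul_cancel₀ hh, one_mul, one_mul]
    _ = _ := by ring

/-- `(S P₁ v)ᵢ` is a primitive of `(S z)ᵢ`. -/
lemma S_mulVec_eq_primitive (hP1 : IsUnit sys.P1)
    (hP0 : ∀ᵐ ξ ∂sys.vol, D.P0D ξ = 0) {x z : sys.State} {v : ℝ → EuclideanSpace 𝕜 (Fin n)}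
    (hev : sys.Evolution x z v) (i : Fin n) {ξ : ℝ} (hξ : ξ ∈ Icc sys.a sys.b) :
    (D.S ξ *ᵥ (sys.P1 *ᵥ (v ξ).ofLp)) i = (D.S sys.a *ᵥ (sys.P1 *ᵥ (v sys.a).ofLp)) i +
      ∫ ζ in sys.a..ξ, (D.S ζ *ᵥ (z ζ).ofLp) i := by
  obtain ⟨w, ⟨hw, hv⟩, -, hz⟩ := hev
  have hwi : IntervalIntegrable w volume sys.a sys.b := by
    rw [intervalIntegrable_iff_integrableOn_Icc_of_le sys.hab.le]
    exact hw.integrable one_le_two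
  have hwj : ∀ j, IntervalIntegrable (fun ζ => (w ζ).ofLp j) volume sys.a sys.b := fun j =>
    ⟨(EuclideanSpace.proj j : EuclideanSpace 𝕜 (Fin n) →L[𝕜] 𝕜).integrable_comp hwi.1,
      (EuclideanSpace.proj j : EuclideanSpace 𝕜 (Fin n) →L[𝕜] 𝕜).integrable_comp hwi.2⟩
  have hvj : ∀ j, ∀ ξ ∈ Icc sys.a sys.b,
      (v ξ).ofLp j = (v sys.a).ofLp j + ∫ ζ in sys.a..ξ, (w ζ).ofLp j := by
    intro j ξ hξ
    have hwξ : IntervalIntegrable w volume sys.a ξ := hwi.mono_set (by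
      rw [uIcc_of_le hξ.1, uIcc_of_le sys.hab.le]; exact Icc_subset_Icc_right hξ.2)
    have := (EuclideanSpace.proj j : EuclideanSpace 𝕜 (Fin n) →L[𝕜] 𝕜).intervalIntegral_comp_comm
      hwξ
    simp only [EuclideanSpace.coe_proj] at this
    rw [this, hv ξ hξ]
    simp
  have hprod : ∀ j, IntervalIntegrable (fun ζ => (D.derivS ζ * sys.P1) i j * (v ζ).ofLp j +
        (D.S ζ * sys.P1) i j * (w ζ).ofLp j) volume sys.a ξ ∧
      (D.S ξ * sys.P1) i j * (v ξ).ofLp j =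
      (D.S sys.a * sys.P1) i j * (v sys.a).ofLp j + ∫ ζ in sys.a..ξ,
        ((D.derivS ζ * sys.P1) i j * (v ζ).ofLp j + (D.S ζ * sys.P1) i j * (w ζ).ofLp j) := by
    intro j
    refine mul_primitive_eq (c := fun ζ => (D.S ζ * sys.P1) i j)
      (c' := fun ζ => (D.derivS ζ * sys.P1) i j) (v := fun ζ => (v ζ).ofLp j)
      (w := fun ζ => (w ζ).ofLp j) (fun ζ hζ => ?_) ?_ (hwj j) (hvj j) hξ
    · simp_rw [Matrix.mul_apply]
      exact HasDerivWithinAt.fun_sum fun k _ => (D.hasDerivWithinAt_S hζ i k).mul_const _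
    · simp_rw [Matrix.mul_apply]
      exact continuousOn_finsetSum _ fun k _ => (D.continuousOn_derivS i k).mul continuousOn_const
  -- By `S' P₁ = S P₀`, the derivative `S' P₁ v + S P₁ w` of `S P₁ v` equals `S (P₀ v + P₁ w) = S
  -- z`.
  have hsum : ∫ ζ in sys.a..ξ, (D.S ζ *ᵥ (z ζ).ofLp) i = ∑ j, ∫ ζ in sys.a..ξ,
      ((D.derivS ζ * sys.P1) i j * (v ζ).ofLp j + (D.S ζ * sys.P1) i j * (w ζ).ofLp j) := by
    rw [← intervalIntegral.integral_finsetSum fun j _ => (hprod j).1]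
    refine intervalIntegral.integral_congr_ae ?_
    rw [ae_restrict_iff' measurableSet_Icc] at hP0 hz
    filter_upwards [hP0, hz] with ζ h0 hz hmem
    rw [uIoc_of_le hξ.1] at hmem
    have hζ : ζ ∈ Icc sys.a sys.b := ⟨hmem.1.le, hmem.2.trans hξ.2⟩
    rw [hz hζ, Finset.sum_add_distrib, D.derivS_mul_P1 hP1 hζ (h0 hζ), Matrix.mulVec_add,
      Matrix.mulVec_mulVec, Matrix.mulVec_mulVec, add_comm]
    rfl
  rw [hsum, Matrix.mulVec_mulVec, Matrix.mulVec_mulVec]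
  simp only [Matrix.mulVec, dotProduct]
  rw [← Finset.sum_add_distrib]
  exact Finset.sum_congr rfl fun j _ => (hprod j).2

/-- The balance law obtained by testing the evolution equation with a function that is transported
along the characteristics. -/
lemma inner_shiftVec_balance (hP1 : IsUnit sys.P1)
    (hP0 : ∀ᵐ ξ ∂sys.vol, D.P0D ξ = 0) {x z : sys.State} {v : ℝ → EuclideanSpace 𝕜 (Fin n)}
    (hev : sys.Evolution x z v) (i : Fin n) {ψ : ℝ → ℝ} (hψ : ContDiff ℝ 1 ψ) (t : ℝ) :
    inner 𝕜 (D.shiftVec i ψ hψ.continuous t) z +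
        inner 𝕜 (D.shiftVec i (deriv ψ) (hψ.continuous_deriv le_rfl) t) x =
      (ψ (t + D.travelTime i) : 𝕜) * D.inflow v i - (ψ t : 𝕜) * D.outflow v i := by
  have hφ : ∀ ξ, HasDerivAt (fun ξ => ψ (t + D.arrival i ξ))
      (deriv ψ (t + D.arrival i ξ) * (D.sgn i * D.slowness i ξ)) ξ := fun ξ =>
    ((hψ.differentiable one_ne_zero).differentiableAt.hasDerivAt (x := t + D.arrival i ξ)).comp ξ
      ((D.hasDerivAt_arrival i ξ).const_add t)
  have hφc : Continuous fun ξ => deriv ψ (t + D.arrival i ξ) * (D.sgn i * D.slowness i ξ) :=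
    ((hψ.continuous_deriv le_rfl).comp (continuous_const.add (D.continuous_arrival i))).mul
      (continuous_const.mul (D.continuous_slowness i))
  have hprod := (mul_primitive_eq (𝕜 := 𝕜) (a := sys.a) (b := sys.b)
    (c := fun ξ => (ψ (t + D.arrival i ξ) : 𝕜))
    (c' := fun ξ => ((deriv ψ (t + D.arrival i ξ) * (D.sgn i * D.slowness i ξ) : ℝ) : 𝕜))
    (v := fun ξ => (D.S ξ *ᵥ (sys.P1 *ᵥ (v ξ).ofLp)) i) (w := fun ξ => (D.S ξ *ᵥ (z ξ).ofLp) i)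
    (fun ξ _ => ((RCLike.ofRealCLM (K := 𝕜)).hasFDerivAt.comp_hasDerivAt ξ (hφ ξ)).hasDerivWithinAt)
    (RCLike.continuous_ofReal.comp hφc).continuousOn (D.intervalIntegrable_S_mulVec z i)
    (fun ξ hξ => D.S_mulVec_eq_primitive hP1 hP0 hev i hξ) (right_mem_Icc.mpr sys.hab.le)).2
  have hc1 : Continuous fun ξ => ψ (t + D.arrival i ξ) :=
    hψ.continuous.comp (continuous_const.add (D.continuous_arrival i))
  have hc2 : Continuous fun ξ => deriv ψ (t + D.arrival i ξ) :=
    (hψ.continuous_deriv le_rfl).comp (continuous_const.add (D.continuous_arrival i))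
  rw [shiftVec, shiftVec, D.inner_testVec, D.inner_testVec,
    ← integral_add (D.integrable_testVec i hc1 z) (D.integrable_testVec i hc2 x)]
  -- The integrand is the spatial derivative of `ψ(t + arrival) (S P₁ v)ᵢ`, so only boundary terms
  -- survive.
  have h_int : ∫ ξ, ((ψ (t + D.arrival i ξ) : 𝕜) * (D.S ξ *ᵥ (z ξ).ofLp) i +
      ((deriv ψ (t + D.arrival i ξ) : ℝ) : 𝕜) * (D.S ξ *ᵥ (x ξ).ofLp) i) ∂sys.vol =
      ∫ ξ in sys.a..sys.b, (((deriv ψ (t + D.arrival i ξ) * (D.sgn i * D.slowness i ξ) : ℝ) : 𝕜) *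
        (D.S ξ *ᵥ (sys.P1 *ᵥ (v ξ).ofLp)) i +
        (ψ (t + D.arrival i ξ) : 𝕜) * (D.S ξ *ᵥ (z ξ).ofLp) i) := by
    rw [intervalIntegral.integral_of_le sys.hab.le, ← integral_Icc_eq_integral_Ioc]
    refine integral_congr_ae ?_
    filter_upwards [D.S_mulVec_state hev i] with ξ hξ
    rw [hξ]
    push_cast
    ring
  rw [h_int, ← sub_eq_iff_eq_add'.mpr hprod]
  simp only [D.arrival_a, D.arrival_b, inflow, outflow, D.effort_apply]
  -- For the second group of indices the roles of the endpoints and the sign in the effort are both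
  -- reversed, so the balance has the same form.
  by_cases hi : (i : ℕ) < D.m
  · simp [hi, sgn]
  · simp only [hi, sgn, if_false, add_zero]
    push_cast
    ring

/-- The time derivative of a trajectory tested along the characteristics. -/
lemma hasDerivWithinAt_inner_shiftVec (hP1 : IsUnit sys.P1)
    (hP0 : ∀ᵐ ξ ∂sys.vol, D.P0D ξ = 0) {X : ℝ → sys.State} {z : sys.State}
    {v : ℝ → EuclideanSpace 𝕜 (Fin n)} {t : ℝ} (hX : HasDerivWithinAt X z (Ici t) t)
    (hev : sys.Evolution (X t) z v) (i : Fin n) {ψ : ℝ → ℝ} (hψ : ContDiff ℝ 1 ψ)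
    (hsupp : HasCompactSupport ψ) :
    HasDerivWithinAt (fun s => inner 𝕜 (D.shiftVec i ψ hψ.continuous s) (X s))
      ((ψ (t + D.travelTime i) : 𝕜) * D.inflow v i - (ψ t : 𝕜) * D.outflow v i) (Ici t) t := by
  rw [← D.inner_shiftVec_balance hP1 hP0 hev i hψ t]
  exact HasDerivWithinAt.inner 𝕜 (D.hasDerivAt_shiftVec i hψ hsupp t).hasDerivWithinAt hX

end HBCS.Diagonalisation

/-! ### The boundary conditions in terms of inflow and outflow -/

namespace HBCS.Diagonalisation

variable {𝕜 : Type*} [RCLike 𝕜] {n : ℕ} {sys : HBCS 𝕜 n} (D : sys.Diagonalisation)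

lemma Qplus_add_Qminus : D.system.Qplus + D.system.Qminus = 1 := by
  rw [D.system_Qplus, D.system_Qminus, Matrix.diagonal_add, ← Matrix.diagonal_one]
  congr 1
  ext i
  split_ifs <;> simp

lemma Qplus_mul_Qplus : D.system.Qplus * D.system.Qplus = D.system.Qplus := by
  rw [D.system_Qplus, Matrix.diagonal_mul_diagonal]
  congr 1
  ext i
  split_ifs <;> simp

lemma Qminus_mul_Qminus : D.system.Qminus * D.system.Qminus = D.system.Qminus := by
  rw [D.system_Qminus, Matrix.diagonal_mul_diagonal]
  congr 1
  ext i
  split_ifs <;> simp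

lemma Qplus_mul_Qminus : D.system.Qplus * D.system.Qminus = 0 := by
  rw [D.system_Qplus, D.system_Qminus, Matrix.diagonal_mul_diagonal, ← Matrix.diagonal_zero]
  congr 1
  ext i
  split_ifs <;> simp

lemma Qminus_mul_Qplus : D.system.Qminus * D.system.Qplus = 0 := by
  rw [D.system_Qplus, D.system_Qminus, Matrix.diagonal_mul_diagonal, ← Matrix.diagonal_zero]
  congr 1
  ext i
  split_ifs <;> simp

lemma effort_b_eq (v : ℝ → EuclideanSpace 𝕜 (Fin n)) :
    D.effort v sys.b =
      D.system.Qplus *ᵥ D.inflow v + D.system.Qminus *ᵥ D.outflow v := by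
  ext i
  rw [D.system_Qplus, D.system_Qminus, Pi.add_apply, Matrix.mulVec_diagonal,
    Matrix.mulVec_diagonal, inflow, outflow]
  split_ifs <;> simp

lemma effort_a_eq (v : ℝ → EuclideanSpace 𝕜 (Fin n)) :
    D.effort v sys.a =
      D.system.Qminus *ᵥ D.inflow v + D.system.Qplus *ᵥ D.outflow v := by
  ext i
  rw [D.system_Qplus, D.system_Qminus, Pi.add_apply, Matrix.mulVec_diagonal,
    Matrix.mulVec_diagonal, inflow, outflow]
  split_ifs <;> simp

lemma boundaryTransform_mulVec_effort (hP1 : IsUnit sys.P1) (v : ℝ → EuclideanSpace 𝕜 (Fin n)) :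
    D.boundaryTransform *ᵥ Sum.elim (D.effort v sys.b) (D.effort v sys.a) = sys.trace v := by
  have hP1' : sys.P1⁻¹ * sys.P1 = 1 :=
    Matrix.nonsing_inv_mul _ ((Matrix.isUnit_iff_isUnit_det _).mp hP1)
  have key : ∀ ξ ∈ Icc sys.a sys.b,
      (sys.P1⁻¹ * (D.S ξ)⁻¹ * P1D 𝕜 n D.m) *ᵥ D.effort v ξ = (v ξ).ofLp := by
    intro ξ hξ
    rw [effort, Matrix.mulVec_mulVec, Matrix.mulVec_mulVec, Matrix.mulVec_mulVec,
      Matrix.mul_assoc (sys.P1⁻¹ * _), P1D_mul_self, Matrix.mul_one, Matrix.mul_assoc sys.P1⁻¹,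
      D.S_inv_mul hξ, Matrix.mul_one, hP1', Matrix.one_mulVec]
  rw [boundaryTransform, Matrix.fromBlocks_mulVec, trace]
  simp only [Sum.elim_comp_inl, Sum.elim_comp_inr, Matrix.zero_mulVec, add_zero, zero_add]
  rw [key _ (right_mem_Icc.mpr sys.hab.le), key _ (left_mem_Icc.mpr sys.hab.le)]

lemma isUnit_boundaryTransform (hP1 : IsUnit sys.P1) : IsUnit D.boundaryTransform := by
  have key : ∀ ξ ∈ Icc sys.a sys.b, IsUnit (sys.P1⁻¹ * (D.S ξ)⁻¹ * P1D 𝕜 n D.m) := by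
    intro ξ hξ
    refine ((Matrix.isUnit_nonsing_inv_iff.mpr hP1).mul
      (Matrix.isUnit_nonsing_inv_iff.mpr (D.S_unit ξ hξ))).mul ?_
    exact IsUnit.of_mul_eq_one _ (P1D_mul_self D.m)
  rw [Matrix.isUnit_iff_isUnit_det, boundaryTransform, Matrix.det_fromBlocks_zero₂₁]
  exact ((Matrix.isUnit_iff_isUnit_det _).mp (key _ (right_mem_Icc.mpr sys.hab.le))).mul
    ((Matrix.isUnit_iff_isUnit_det _).mp (key _ (left_mem_Icc.mpr sys.hab.le)))

/-- The coefficient of the inflow in the input. -/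
def inflowMatrix : Matrix (Fin n) (Fin n) 𝕜 :=
  D.system.WB.toCols₁ * D.system.Qplus + D.system.WB.toCols₂ * D.system.Qminus

/-- The coefficient of the outflow in the input. -/
def outflowMatrix : Matrix (Fin n) (Fin n) 𝕜 :=
  D.system.WB.toCols₁ * D.system.Qminus + D.system.WB.toCols₂ * D.system.Qplus

lemma WB_mulVec_trace (hP1 : IsUnit sys.P1) (v : ℝ → EuclideanSpace 𝕜 (Fin n)) :
    sys.WB *ᵥ sys.trace v = D.inflowMatrix *ᵥ D.inflow v + D.outflowMatrix *ᵥ D.outflow v := by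
  rw [← D.boundaryTransform_mulVec_effort hP1 v, Matrix.mulVec_mulVec]
  change D.system.WB *ᵥ _ = _
  conv_lhs => rw [← Matrix.fromCols_toCols D.system.WB]
  rw [Matrix.fromCols_mulVec, Sum.elim_comp_inl, Sum.elim_comp_inr, D.effort_a_eq, D.effort_b_eq,
    inflowMatrix, outflowMatrix]
  simp only [Matrix.mulVec_add, Matrix.add_mulVec, Matrix.mulVec_mulVec]
  abel

lemma toCols₁_eq : D.system.WB.toCols₁ =
    D.inflowMatrix * D.system.Qplus + D.outflowMatrix * D.system.Qminus := by
  simp only [inflowMatrix, outflowMatrix, Matrix.add_mul, Matrix.mul_assoc, D.Qplus_mul_Qplus,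
    D.Qminus_mul_Qminus, D.Qplus_mul_Qminus, D.Qminus_mul_Qplus, Matrix.mul_zero, add_zero]
  rw [← Matrix.mul_add, D.Qplus_add_Qminus, Matrix.mul_one]

lemma toCols₂_eq : D.system.WB.toCols₂ =
    D.inflowMatrix * D.system.Qminus + D.outflowMatrix * D.system.Qplus := by
  simp only [inflowMatrix, outflowMatrix, Matrix.add_mul, Matrix.mul_assoc, D.Qplus_mul_Qplus,
    D.Qminus_mul_Qminus, D.Qplus_mul_Qminus, D.Qminus_mul_Qplus, Matrix.mul_zero, zero_add]
  rw [← Matrix.mul_add, add_comm D.system.Qminus, D.Qplus_add_Qminus, Matrix.mul_one]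

/-- The two blocks of `W_B^D` are recovered from the inflow and outflow coefficients through the
complementary projections `Q₊` and `Q₋`; factoring out the inflow coefficient leaves the required
form. -/
lemma isDecomposition_of_isUnit (h : IsUnit D.inflowMatrix) :
    D.system.IsDecomposition D.inflowMatrix (-(D.inflowMatrix⁻¹ * D.outflowMatrix)) := by
  refine ⟨h, ?_⟩
  have hinv : D.inflowMatrix * D.inflowMatrix⁻¹ = 1 :=
    Matrix.mul_nonsing_inv _ ((Matrix.isUnit_iff_isUnit_det _).mp h)
  rw [Matrix.mul_fromCols]
  conv_lhs => rw [← Matrix.fromCols_toCols D.system.WB, D.toCols₁_eq, D.toCols₂_eq]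
  congr 1
  · rw [Matrix.mul_sub, neg_mul, mul_neg, sub_neg_eq_add, Matrix.mul_assoc, ← Matrix.mul_assoc,
      ← Matrix.mul_assoc, hinv, Matrix.one_mul]
  · rw [Matrix.mul_sub, neg_mul, mul_neg, sub_neg_eq_add, Matrix.mul_assoc, ← Matrix.mul_assoc,
      ← Matrix.mul_assoc, hinv, Matrix.one_mul]

/-- Any decomposition has inflow coefficient `K` and outflow coefficient `-K M`, by orthogonality of
the projections. -/
lemma input_eq_of_isDecomposition (hP1 : IsUnit sys.P1) {K M : Matrix (Fin n) (Fin n) 𝕜}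
    (hKM : D.system.IsDecomposition K M) (v : ℝ → EuclideanSpace 𝕜 (Fin n)) :
    sys.WB *ᵥ sys.trace v = K *ᵥ (D.inflow v - M *ᵥ D.outflow v) := by
  rw [D.WB_mulVec_trace hP1 v, inflowMatrix, outflowMatrix, hKM.2, Matrix.mul_fromCols,
    Matrix.toCols₁_fromCols, Matrix.toCols₂_fromCols, Matrix.mulVec_sub, Matrix.mulVec_mulVec]
  have h1 : K * (D.system.Qplus - M * D.system.Qminus) * D.system.Qplus +
      K * (D.system.Qminus - M * D.system.Qplus) * D.system.Qminus = K := by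
    simp only [Matrix.mul_assoc, Matrix.sub_mul, D.Qplus_mul_Qplus,
      D.Qminus_mul_Qminus, D.Qplus_mul_Qminus, D.Qminus_mul_Qplus, Matrix.mul_zero, sub_zero]
    rw [← Matrix.mul_add, D.Qplus_add_Qminus, Matrix.mul_one]
  have h2 : K * (D.system.Qplus - M * D.system.Qminus) * D.system.Qminus +
      K * (D.system.Qminus - M * D.system.Qplus) * D.system.Qplus = -(K * M) := by
    simp only [Matrix.mul_assoc, Matrix.sub_mul, D.Qplus_mul_Qplus,
      D.Qminus_mul_Qminus, D.Qplus_mul_Qminus, D.Qminus_mul_Qplus, zero_sub, mul_neg]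
    rw [← neg_add, ← Matrix.mul_add, ← Matrix.mul_add, add_comm D.system.Qminus,
      D.Qplus_add_Qminus, Matrix.mul_one]
  rw [h1, h2, Matrix.neg_mulVec, sub_eq_add_neg]

end HBCS.Diagonalisation

/-! ### Generation of a semigroup forces the inflow matrix to be invertible -/

lemma Matrix.eq_zero_of_vecMul_eq_zero_of_rank {𝕜 ι : Type*} [Field 𝕜] [Fintype ι] {n : ℕ}
    {W : Matrix (Fin n) ι 𝕜} (hW : W.rank = n) {w : Fin n → 𝕜} (hw : w ᵥ* W = 0) : w = 0 := by
  classical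
  have hrange : LinearMap.range W.mulVecLin = ⊤ := by
    refine Submodule.eq_top_of_finrank_eq ?_
    rw [Module.finrank_fin_fun]
    exact hW
  ext i
  obtain ⟨x, hx⟩ := LinearMap.range_eq_top.mp hrange (Pi.single i 1)
  have h1 : w ⬝ᵥ W *ᵥ x = 0 := by rw [Matrix.dotProduct_mulVec, hw, zero_dotProduct]
  rw [Matrix.mulVecLin_apply] at hx
  rwa [hx, dotProduct_single, mul_one] at h1

/-- A smooth function with compact support which vanishes outside `(0, δ)` but not at `δ / 2`. -/
lemma exists_smooth_test_function {δ : ℝ} (hδ : 0 < δ) :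
    ∃ ψ : ℝ → ℝ, ContDiff ℝ 1 ψ ∧ HasCompactSupport ψ ∧ ψ (δ / 2) ≠ 0 ∧
      ∀ t, δ ≤ t → ψ t = 0 := by
  let f : ContDiffBump (δ / 2) := ⟨δ / 4, δ / 2, by linarith, by linarith⟩
  refine ⟨f, f.contDiff, f.hasCompactSupport, ?_, fun t ht => ?_⟩
  · rw [f.one_of_mem_closedBall (Metric.mem_closedBall_self f.rIn_pos.le)]
    exact one_ne_zero
  · refine f.zero_of_le_dist ?_
    rw [Real.dist_eq]
    refine le_trans ?_ (le_abs_self _)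
    change δ / 2 ≤ t - δ / 2
    linarith

namespace HBCS.Diagonalisation

variable {𝕜 : Type*} [RCLike 𝕜] {n : ℕ} {sys : HBCS 𝕜 n} (D : sys.Diagonalisation)

lemma exists_delay_lower_bound : ∃ δ : ℝ, 0 < δ ∧ ∀ i, δ ≤ D.travelTime i := by
  rcases isEmpty_or_nonempty (Fin n) with h | h
  · exact ⟨1, one_pos, fun i => h.elim i⟩
  · obtain ⟨i, hi⟩ := Finite.exists_min D.travelTime
    exact ⟨_, D.travelTime_pos i, hi⟩

/-- A combination of rows of test vectors that vanishes has vanishing coefficients. -/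
lemma coeff_eq_zero_of_sum_shiftVec_eq_zero {δ : ℝ} (hδ : 0 < δ)
    (hδτ : ∀ i, δ ≤ D.travelTime i) {ψ : ℝ → ℝ} (hψ : Continuous ψ) (hψ0 : ψ (δ / 2) ≠ 0)
    {c : Fin n → 𝕜} (hc : ∀ x, ∑ i, c i * inner 𝕜 (D.shiftVec i ψ hψ 0) x = 0) : c = 0 := by
  -- The coefficients are conjugated because the inner product is conjugate linear in its first
  -- argument.
  set Y : sys.State := ∑ i, (star (c i)) • D.shiftVec i ψ hψ 0 with hY
  have hY0 : Y = 0 := by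
    refine ext_inner_right 𝕜 fun x => ?_
    rw [hY, sum_inner, inner_zero_left, ← hc x]
    refine Finset.sum_congr rfl fun i _ => ?_
    rw [inner_smul_left]
    simp
  have hae : ∀ᵐ ξ ∂sys.vol, ∑ i, star (c i) • (ψ (D.arrival i ξ) • D.row i ξ) = 0 := by
    have h1 : ∀ᵐ ξ ∂sys.vol, ∀ i, D.shiftVec i ψ hψ 0 ξ = ψ (0 + D.arrival i ξ) • D.row i ξ :=
      ae_all_iff.mpr fun i => D.coeFn_shiftVec i hψ 0
    have h2 : ∀ᵐ ξ ∂sys.vol, ∀ i, (star (c i) • D.shiftVec i ψ hψ 0 : sys.State) ξ =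
        star (c i) • D.shiftVec i ψ hψ 0 ξ :=
      ae_all_iff.mpr fun i => Lp.coeFn_smul _ _
    have h3 : Y =ᵐ[sys.vol] fun ξ => ∑ i, (star (c i) • D.shiftVec i ψ hψ 0 : sys.State) ξ := by
      rw [hY]
      exact Lp.coeFn_fun_finsetSum _ _
    have h4 : Y =ᵐ[sys.vol] 0 := by
      rw [hY0]
      exact Lp.coeFn_zero _ _ _
    filter_upwards [h1, h2, h3, h4] with ξ h1 h2 h3 h4
    rw [h3] at h4
    simp only [h1, h2, zero_add] at h4
    exact h4
  -- The rows of the invertible matrix `S(ξ)` are independent, so the sum vanishes term by term.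
  have hcomp : ∀ i, ∀ᵐ ξ ∂sys.vol, c i * (ψ (D.arrival i ξ) : 𝕜) = 0 := by
    intro i
    filter_upwards [hae, ae_restrict_mem measurableSet_Icc] with ξ hξ hmem
    have hvec : (fun i => c i * (ψ (D.arrival i ξ) : 𝕜)) ᵥ* D.S ξ = 0 := by
      ext j
      have := congrArg (fun u : EuclideanSpace 𝕜 (Fin n) => star (u.ofLp j)) hξ
      simp only [row, WithLp.ofLp_sum, Finset.sum_apply, star_sum] at this
      rw [Pi.zero_apply, Matrix.vecMul, dotProduct]
      refine Eq.trans (Finset.sum_congr rfl fun i _ => ?_) (this.trans (by simp))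
      simp [RCLike.real_smul_eq_coe_mul, mul_assoc]
    have := congrArg (· ᵥ* (D.S ξ)⁻¹) hvec
    simp only [Matrix.vecMul_vecMul, D.S_mul_inv hmem, Matrix.vecMul_one,
      Matrix.zero_vecMul] at this
    exact congr_fun this i
  ext i
  by_contra hci
  have hzero : ∀ᵐ ξ ∂sys.vol, ψ (D.arrival i ξ) = 0 := by
    filter_upwards [hcomp i] with ξ hξ
    rcases mul_eq_zero.mp hξ with h | h
    · exact absurd h hci
    · exact_mod_cast h
  have hall : EqOn (fun ξ => ψ (D.arrival i ξ)) (fun _ => 0) (Icc sys.a sys.b) :=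
    Measure.eqOn_Icc_of_ae_eq volume sys.hab.ne hzero
      (hψ.comp (D.continuous_arrival i)).continuousOn continuousOn_const
  -- The arrival time runs through all of `[0, τᵢ]`, which contains `δ / 2`.
  have hivt : δ / 2 ∈ D.arrival i '' Icc sys.a sys.b := by
    have hτ := hδτ i
    by_cases hi : (i : ℕ) < D.m
    · refine intermediate_value_Icc sys.hab.le (D.continuous_arrival i).continuousOn ?_
      rw [D.arrival_a, D.arrival_b, if_pos hi, if_pos hi]
      constructor <;> linarith
    · refine intermediate_value_Icc' sys.hab.le (D.continuous_arrival i).continuousOn ?_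
      rw [D.arrival_a, D.arrival_b, if_neg hi, if_neg hi]
      constructor <;> linarith
  obtain ⟨ξ, hξ, hξδ⟩ := hivt
  exact hψ0 (by simpa [hξδ] using hall hξ)

/-- A left null vector `w` of the inflow coefficient turns the homogeneous boundary condition into a
constraint `c ⬝ outflow = 0` with `c ≠ 0`. On a time span shorter than every travel time the outflow
is determined by the initial state alone, so this constrains all initial states in the domain,
contradicting its density. -/
theorem isUnit_inflowMatrix (hsys : sys.Admissible) (hP0 : ∀ᵐ ξ ∂sys.vol, D.P0D ξ = 0) :
    IsUnit D.inflowMatrix := by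
  rw [Matrix.isUnit_iff_isUnit_det, isUnit_iff_ne_zero]
  intro hdet
  obtain ⟨w, hw0, hw⟩ := Matrix.exists_vecMul_eq_zero_iff.mpr hdet
  set c : Fin n → 𝕜 := w ᵥ* D.outflowMatrix with hc
  -- If both coefficients were annihilated by `w`, so would be `W_B`, against its full rank.
  have hc0 : c ≠ 0 := by
    intro h0
    refine hw0 (Matrix.eq_zero_of_vecMul_eq_zero_of_rank hsys.WB_rank ?_)
    have h1 : w ᵥ* D.system.WB = 0 := by
      rw [← Matrix.fromCols_toCols D.system.WB, D.toCols₁_eq, D.toCols₂_eq, Matrix.vecMul_fromCols]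
      simp only [Matrix.vecMul_add, ← Matrix.vecMul_vecMul, hw, ← hc, h0, Matrix.zero_vecMul,
        add_zero]
      ext j
      rcases j with j | j <;> rfl
    have hR : D.boundaryTransform * D.boundaryTransform⁻¹ = 1 :=
      Matrix.mul_nonsing_inv _
        ((Matrix.isUnit_iff_isUnit_det _).mp (D.isUnit_boundaryTransform hsys.P1_unit))
    have h2 : w ᵥ* (sys.WB * D.boundaryTransform) ᵥ* D.boundaryTransform⁻¹ = 0 := by
      change w ᵥ* D.system.WB ᵥ* _ = 0
      rw [h1, Matrix.zero_vecMul]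
    rwa [Matrix.vecMul_vecMul, Matrix.mul_assoc, hR, Matrix.mul_one] at h2
  obtain ⟨δ, hδ, hδτ⟩ := D.exists_delay_lower_bound
  obtain ⟨ψ, hψ, hsupp, hψ0, hψδ⟩ := exists_smooth_test_function hδ
  obtain ⟨T, hT0, hTadd, hTcont, hTG⟩ := hsys.generates
  refine hc0 (D.coeff_eq_zero_of_sum_shiftVec_eq_zero hδ hδτ hψ.continuous hψ0 fun x => ?_)
  have hdense := dense_domain_of_semigroup hT0 hTadd hTcont hTG
  have hcontinuous : Continuous fun x : sys.State =>
      ∑ i, c i * inner 𝕜 (D.shiftVec i ψ hψ.continuous 0) x := by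
    fun_prop
  refine congr_fun (hcontinuous.ext_on hdense continuous_const ?_ :
    (fun x : sys.State => ∑ i, c i * inner 𝕜 (D.shiftVec i ψ hψ.continuous 0) x) = fun _ => 0) x
  rintro x₀ ⟨z₀, hxz⟩
  let X : ℝ → sys.State := fun t => T t.toNNReal x₀
  have hX : Continuous X := (hTcont x₀).comp continuous_real_toNNReal
  let F : ℝ → 𝕜 := fun t => ∑ i, c i * inner 𝕜 (D.shiftVec i ψ hψ.continuous t) (X t)
  have hF : Continuous F := by
    refine continuous_finsetSum _ fun i _ => continuous_const.mul (Continuous.inner ?_ hX)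
    exact continuous_iff_continuousAt.mpr fun t => (D.hasDerivAt_shiftVec i hψ hsupp t).continuousAt
  -- After time zero `ψ(t + τᵢ)` vanishes, which removes the inflow; the outflow enters only through
  -- `c ⬝ outflow = 0`.
  have hderiv : ∀ t ∈ Ico 0 δ, HasDerivWithinAt F 0 (Ici t) t := by
    intro t ht
    obtain ⟨v, hev, hbc⟩ := semigroup_domain_invariant hTadd hTG hxz t.toNNReal
    have h1 := semigroup_hasDerivWithinAt hTadd hTG hxz ht.1
    have h2 : HasDerivWithinAt F (∑ i, c i * ((ψ (t + D.travelTime i) : 𝕜) * D.inflow v i -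
        (ψ t : 𝕜) * D.outflow v i)) (Ici t) t :=
      HasDerivWithinAt.fun_sum fun i _ => HasDerivWithinAt.const_mul (c i)
        (D.hasDerivWithinAt_inner_shiftVec hsys.P1_unit hP0 h1 hev i hψ hsupp)
    refine h2.congr_deriv ?_
    have h3 : ∀ i, ψ (t + D.travelTime i) = 0 := fun i =>
      hψδ _ (by linarith [ht.1, hδτ i])
    have h4 : c ⬝ᵥ D.outflow v = 0 := by
      rw [D.WB_mulVec_trace hsys.P1_unit] at hbc
      have := congrArg (w ⬝ᵥ ·) hbc
      simp only [dotProduct_add, Matrix.dotProduct_mulVec, hw, zero_dotProduct, zero_add,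
        dotProduct_zero] at this
      exact this
    calc ∑ i, c i * ((ψ (t + D.travelTime i) : 𝕜) * D.inflow v i - (ψ t : 𝕜) * D.outflow v i)
        = ∑ i, -(ψ t : 𝕜) * (c i * D.outflow v i) := by
          refine Finset.sum_congr rfl fun i _ => ?_
          rw [h3 i]
          push_cast
          ring
      _ = -(ψ t : 𝕜) * (c ⬝ᵥ D.outflow v) := by rw [← Finset.mul_sum]; rfl
      _ = 0 := by rw [h4, mul_zero]
  have hconst := constant_of_has_deriv_right_zero hF.continuousOn hderiv δ ⟨hδ.le, le_rfl⟩
  -- At time `δ` the transported test functions have left the interval.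
  have hend : F δ = 0 := by
    refine Finset.sum_eq_zero fun i _ => ?_
    rw [shiftVec, D.inner_testVec, integral_eq_zero_of_ae, mul_zero]
    filter_upwards [ae_restrict_mem measurableSet_Icc] with ξ hξ
    rw [hψδ _ (by linarith [D.arrival_nonneg i hξ])]
    simp
  have hX0 : X 0 = x₀ := by simp [X, hT0]
  rw [hend] at hconst
  simp only [F, hX0] at hconst
  exact hconst.symm

end HBCS.Diagonalisation

/-! ### Linear delay equations -/

section DelayEquation

open ExpPoly

variable {n : ℕ}

/-- Every factor delays by at least `δ`, so the interval on which the function vanishes grows by `δ`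
at each step. -/
lemma delay_pow_eq_zero (M : Matrix (Fin n) (Fin n) ℂ) {τ : Fin n → ℝ≥0} {δ : ℝ}
    (hδ : ∀ i, δ ≤ τ i) (N : ℕ) (p q : Fin n) {f : ℝ → ℂ} {c : ℝ} (hf : ∀ s ≤ c, f s = 0) {t : ℝ}
    (ht : t ≤ c + N * δ) : delay ((delayMatrix M τ ^ N) p q) f t = 0 := by
  induction N generalizing p q f c with
  | zero =>
    rw [pow_zero, Matrix.one_apply]
    split_ifs
    · simpa using hf t (by simpa using ht)
    · simp
  | succ N ih =>
    rw [pow_succ, Matrix.mul_apply, map_sum, LinearMap.sum_apply, Finset.sum_apply]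
    refine Finset.sum_eq_zero fun r _ => ?_
    rw [map_mul, Module.End.mul_apply]
    refine ih (c := c + δ) p r (fun s hs => ?_) (ht.trans_eq (by push_cast; ring))
    rw [delayMatrix, Matrix.of_apply, delay_single, hf _ (by linarith [hδ q]), mul_zero]

/-- The iterated delay equation. -/
lemma delay_equation_iterate {M : Matrix (Fin n) (Fin n) ℂ} {τ : Fin n → ℝ≥0}
    {F U : Fin n → ℝ → ℂ} (hFU : ∀ p t, F p t = ∑ q, M p q * F q (t - τ q) + U p t) (N : ℕ)
    (p : Fin n) :
    F p = ∑ q, delay ((delayMatrix M τ ^ N) p q) (F q) +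
      ∑ k ∈ Finset.range N, ∑ q, delay ((delayMatrix M τ ^ k) p q) (U q) := by
  have h1 : ∀ p, F p = ∑ q, delay (delayMatrix M τ p q) (F q) + U p := by
    intro p
    ext t
    rw [hFU p t, Pi.add_apply, Finset.sum_apply]
    simp [delayMatrix]
  induction N with
  | zero =>
    simp only [pow_zero, Finset.range_zero, Finset.sum_empty, add_zero, Matrix.one_apply]
    rw [Finset.sum_eq_single p]
    · simp
    · intro q _ hq
      simp [hq.symm]
    · simp
  | succ N ih =>
    have h2 : ∑ q, delay ((delayMatrix M τ ^ N) p q) (F q) =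
        ∑ q, delay ((delayMatrix M τ ^ (N + 1)) p q) (F q) +
          ∑ q, delay ((delayMatrix M τ ^ N) p q) (U q) := by
      have h3 : ∀ q, delay ((delayMatrix M τ ^ N) p q) (F q) =
          ∑ r, delay ((delayMatrix M τ ^ N) p q * delayMatrix M τ q r) (F r) +
            delay ((delayMatrix M τ ^ N) p q) (U q) := by
        intro q
        conv_lhs => rw [h1 q]
        simp only [map_add, map_sum, map_mul, Module.End.mul_apply]
      rw [Finset.sum_congr rfl fun q _ => h3 q, Finset.sum_add_distrib, Finset.sum_comm]
      congr 1
      refine Finset.sum_congr rfl fun r _ => ?_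
      rw [pow_succ, Matrix.mul_apply, map_sum, LinearMap.sum_apply]
    refine ih.trans ?_
    rw [h2, Finset.sum_range_succ]
    abel

/-- Solutions of a delay equation are bounded by the inhomogeneity if the powers of the delay
matrix are summable. -/
lemma norm_le_of_delay_equation {M : Matrix (Fin n) (Fin n) ℂ} {τ : Fin n → ℝ≥0} {δ : ℝ}
    (hδ0 : 0 < δ) (hδ : ∀ i, δ ≤ τ i)
    (hsum : ∀ p q, Summable fun k : ℕ => l1Norm ((delayMatrix M τ ^ k) p q))
    {F U : Fin n → ℝ → ℂ} (hF0 : ∀ p, ∀ t ≤ 0, F p t = 0)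
    (hFU : ∀ p t, F p t = ∑ q, M p q * F q (t - τ q) + U p t) {t B : ℝ} (hB : 0 ≤ B)
    (hU : ∀ q, ∀ s ≤ t, ‖U q s‖ ≤ B) (p : Fin n) :
    ‖F p t‖ ≤ (∑ p, ∑ q, ∑' k : ℕ, l1Norm ((delayMatrix M τ ^ k) p q)) * B := by
  -- After `N ≥ t / δ` substitutions the remainder only sees nonpositive times, where `F` vanishes.
  -- The Neumann series is thus finite at each time, and summability is needed only for uniformity
  -- in `t`.
  obtain ⟨N, hN⟩ := exists_nat_ge (t / δ)
  rw [div_le_iff₀ hδ0] at hN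
  have h1 := congr_fun (delay_equation_iterate hFU N p) t
  have h2 : (∑ q, delay ((delayMatrix M τ ^ N) p q) (F q)) t = 0 := by
    rw [Finset.sum_apply]
    exact Finset.sum_eq_zero fun q _ => delay_pow_eq_zero M hδ N p q (hF0 q) (by simpa using hN)
  rw [Pi.add_apply, h2, zero_add, Finset.sum_apply] at h1
  rw [h1]
  calc ‖∑ k ∈ Finset.range N, (∑ q, delay ((delayMatrix M τ ^ k) p q) (U q)) t‖
      ≤ ∑ k ∈ Finset.range N, ∑ q, l1Norm ((delayMatrix M τ ^ k) p q) * B := by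
        refine (norm_sum_le _ _).trans (Finset.sum_le_sum fun k _ => ?_)
        rw [Finset.sum_apply]
        exact (norm_sum_le _ _).trans (Finset.sum_le_sum fun q _ => norm_delay_le _ (hU q))
    _ = (∑ q, ∑ k ∈ Finset.range N, l1Norm ((delayMatrix M τ ^ k) p q)) * B := by
        rw [Finset.sum_comm, Finset.sum_mul]
        simp_rw [Finset.sum_mul]
    _ ≤ (∑ q, ∑' k : ℕ, l1Norm ((delayMatrix M τ ^ k) p q)) * B := by
        refine mul_le_mul_of_nonneg_right (Finset.sum_le_sum fun q _ => ?_) hB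
        exact (hsum p q).sum_le_tsum _ fun _ _ => l1Norm_nonneg _
    _ ≤ _ := by
        refine mul_le_mul_of_nonneg_right ?_ hB
        exact Finset.single_le_sum
          (f := fun p => ∑ q, ∑' k : ℕ, l1Norm ((delayMatrix M τ ^ k) p q))
          (fun _ _ => Finset.sum_nonneg fun _ _ => tsum_nonneg fun _ => l1Norm_nonneg _)
          (Finset.mem_univ p)

end DelayEquation

/-! ### Passage to complex scalars and essential suprema of continuous functions -/

lemma RCLike.map_complex_mul {𝕜 : Type*} [RCLike 𝕜] (x y : 𝕜) :
    RCLike.map 𝕜 ℂ (x * y) = RCLike.map 𝕜 ℂ x * RCLike.map 𝕜 ℂ y := by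
  apply Complex.ext <;> simp

lemma RCLike.norm_map_complex {𝕜 : Type*} [RCLike 𝕜] (x : 𝕜) : ‖RCLike.map 𝕜 ℂ x‖ = ‖x‖ := by
  simp

/-- A function that is continuous on `[0, t]` is bounded there by its essential supremum. -/
lemma norm_le_eLpNorm_top_of_continuousOn {E : Type*} [NormedAddCommGroup E] {u : ℝ → E} {t : ℝ}
    (ht : 0 < t) (hu : ContinuousOn u (Icc 0 t)) :
    eLpNorm u ⊤ (volume.restrict (Icc 0 t)) ≠ ⊤ ∧
      ∀ s ∈ Icc 0 t, ‖u s‖ ≤ (eLpNorm u ⊤ (volume.restrict (Icc 0 t))).toReal := by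
  obtain ⟨C, hC⟩ := isCompact_Icc.exists_bound_of_continuousOn hu
  have hfin : eLpNorm u ⊤ (volume.restrict (Icc 0 t)) ≠ ⊤ := by
    rw [eLpNorm_exponent_top]
    exact ((eLpNormEssSup_le_of_ae_bound ((ae_restrict_iff' measurableSet_Icc).mpr
      (ae_of_all _ hC))).trans_lt ENNReal.ofReal_lt_top).ne
  refine ⟨hfin, ?_⟩
  set B := (eLpNorm u ⊤ (volume.restrict (Icc 0 t))).toReal with hB
  -- Writing the inequality as `max ‖u‖ B = B` makes it an almost everywhere equality of continuous
  -- functions, which then holds everywhere.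
  have hae : (fun s => max ‖u s‖ B) =ᵐ[volume.restrict (Icc 0 t)] fun _ => B := by
    filter_upwards [ae_le_eLpNormEssSup (f := u) (μ := volume.restrict (Icc 0 t))] with s hs
    refine max_eq_right ?_
    rw [hB, ← toReal_enorm]
    exact ENNReal.toReal_mono hfin hs
  have hall := Measure.eqOn_Icc_of_ae_eq volume ht.ne hae (hu.norm.sup continuousOn_const)
    continuousOn_const
  intro s hs
  exact max_eq_right_iff.mp (hall hs)

/-! ### The outflow as delayed inflow -/

namespace HBCS.Diagonalisation

variable {𝕜 : Type*} [RCLike 𝕜] {n : ℕ} {sys : HBCS 𝕜 n} (D : sys.Diagonalisation)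

/-- A continuous trajectory with continuous inflow and outflow and vanishing initial state: the
outflow is the delayed inflow. -/
lemma outflow_eq_inflow_delayed (hP1 : IsUnit sys.P1) (hP0 : ∀ᵐ ξ ∂sys.vol, D.P0D ξ = 0)
    {X Z : ℝ → sys.State} {v : ℝ → ℝ → EuclideanSpace 𝕜 (Fin n)} (hXc : ContinuousOn X (Ici 0))
    (hX : ∀ t, 0 ≤ t → HasDerivWithinAt X (Z t) (Ici t) t)
    (hev : ∀ t, 0 ≤ t → sys.Evolution (X t) (Z t) (v t)) (hX0 : X 0 = 0) (i : Fin n)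
    {F G : ℝ → 𝕜} (hF : Continuous F) (hG : Continuous G) (hF0 : ∀ t ≤ 0, F t = 0)
    (hG0 : ∀ t ≤ 0, G t = 0) (hFv : ∀ t, 0 ≤ t → F t = D.inflow (v t) i)
    (hGv : ∀ t, 0 ≤ t → G t = D.outflow (v t) i) (t : ℝ) :
    G t = F (t - D.travelTime i) := by
  have hcont : Continuous fun t => F (t - D.travelTime i) - G t :=
    (hF.comp (continuous_id.sub continuous_const)).sub hG
  -- The transport law is proved in weak form in time. The tested trajectory vanishes at time zero
  -- with the state and at time `R` with `ψ`, so the integrated balance law equates `∫ ψ(t + τ) F`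
  -- and `∫ ψ G`.
  have hae : ∀ᵐ t, F (t - D.travelTime i) - G t = 0 := by
    refine ae_eq_zero_of_integral_contDiff_smul_eq_zero hcont.locallyIntegrable
      fun ψ hψ hsupp => ?_
    have hψ1 : ContDiff ℝ 1 ψ := hψ.of_le (by exact_mod_cast le_top)
    obtain ⟨R, hR0, hR⟩ : ∃ R : ℝ, 0 < R ∧ ∀ t, R ≤ t → ψ t = 0 := by
      obtain ⟨R, hR⟩ := hsupp.isCompact.isBounded.subset_ball 0
      refine ⟨max R 1, lt_max_of_lt_right one_pos, fun t ht => ?_⟩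
      refine image_eq_zero_of_notMem_tsupport fun hmem => ?_
      have := hR hmem
      rw [Metric.mem_ball, dist_zero_right, Real.norm_eq_abs] at this
      exact absurd ((le_max_left R 1).trans ht) (not_le.mpr ((le_abs_self t).trans_lt this))
    let b : ℝ → 𝕜 := fun t => inner 𝕜 (D.shiftVec i ψ hψ.continuous t) (X t)
    have hbc : ContinuousOn b (Icc 0 R) := by
      refine ContinuousOn.inner ?_ (hXc.mono Icc_subset_Ici_self)
      exact fun t _ =>
        (D.hasDerivAt_shiftVec i hψ1 hsupp t).continuousAt.continuousWithinAt
    let b' : ℝ → 𝕜 := fun t => (ψ (t + D.travelTime i) : 𝕜) * F t - (ψ t : 𝕜) * G t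
    have hb'1 : Continuous fun t => (ψ (t + D.travelTime i) : 𝕜) * F t :=
      (RCLike.continuous_ofReal.comp (hψ.continuous.comp
        (continuous_id.add continuous_const))).mul hF
    have hb'2 : Continuous fun t => (ψ t : 𝕜) * G t :=
      (RCLike.continuous_ofReal.comp hψ.continuous).mul hG
    have hderiv : ∀ t ∈ Ioo 0 R, HasDerivWithinAt b (b' t) (Ioi t) t := by
      intro t ht
      have := D.hasDerivWithinAt_inner_shiftVec hP1 hP0 (hX t ht.1.le) (hev t ht.1.le) i hψ1 hsupp
      rw [← hFv t ht.1.le, ← hGv t ht.1.le] at this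
      exact this.mono Ioi_subset_Ici_self
    have hftc := intervalIntegral.integral_eq_sub_of_hasDeriv_right_of_le hR0.le hbc hderiv
      ((hb'1.sub hb'2).intervalIntegrable _ _)
    have hb0 : b 0 = 0 := by simp only [b, hX0, inner_zero_right]
    have hbR : b R = 0 := by
      simp only [b]
      rw [shiftVec, D.inner_testVec, integral_eq_zero_of_ae]
      filter_upwards [ae_restrict_mem measurableSet_Icc] with ξ hξ
      rw [hR _ (by linarith [D.arrival_nonneg i hξ])]
      simp
    rw [hb0, hbR, sub_zero, intervalIntegral.integral_sub (hb'1.intervalIntegrable _ _)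
      (hb'2.intervalIntegrable _ _)] at hftc
    -- The integral extends to the whole line: `F` vanishes up to time zero and `ψ(t + τ)` beyond
    -- `R`.
    have hs1 : ∫ t in (0 : ℝ)..R, (ψ (t + D.travelTime i) : 𝕜) * F t =
        ∫ t, (ψ (t + D.travelTime i) : 𝕜) * F t := by
      refine intervalIntegral.integral_eq_integral_of_support_subset fun t ht => ?_
      by_contra hcon
      refine ht ?_
      beta_reduce
      rcases not_and_or.mp hcon with h | h
      · rw [hF0 t (not_lt.mp h), mul_zero]
      · rw [hR _ (by linarith [D.travelTime_pos i, not_le.mp h])]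
        simp
    have hs2 : ∫ t in (0 : ℝ)..R, (ψ t : 𝕜) * G t = ∫ t, (ψ t : 𝕜) * G t := by
      refine intervalIntegral.integral_eq_integral_of_support_subset fun t ht => ?_
      by_contra hcon
      refine ht ?_
      beta_reduce
      rcases not_and_or.mp hcon with h | h
      · rw [hG0 t (not_lt.mp h), mul_zero]
      · rw [hR _ (not_le.mp h).le]
        simp
    have hshift : ∫ t, (ψ (t + D.travelTime i) : 𝕜) * F t =
        ∫ t, (ψ t : 𝕜) * F (t - D.travelTime i) := by
      rw [← integral_add_right_eq_self (fun t => (ψ t : 𝕜) * F (t - D.travelTime i))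
        (D.travelTime i)]
      simp
    rw [hs1, hs2, hshift] at hftc
    have hint1 : Integrable fun t => (ψ t : 𝕜) * F (t - D.travelTime i) := by
      refine Continuous.integrable_of_hasCompactSupport ((RCLike.continuous_ofReal.comp
        hψ.continuous).mul (hF.comp (continuous_id.sub continuous_const))) ?_
      exact (hsupp.comp_left RCLike.ofReal_zero).mul_right
    have hint2 : Integrable fun t => (ψ t : 𝕜) * G t :=
      Continuous.integrable_of_hasCompactSupport hb'2
        (hsupp.comp_left RCLike.ofReal_zero).mul_right
    rw [← integral_sub hint1 hint2] at hftc
    rw [← hftc]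
    refine integral_congr_ae (ae_of_all _ fun t => ?_)
    simp only [RCLike.real_smul_eq_coe_mul]
    ring
  have hzero : (fun t => F (t - D.travelTime i) - G t) = fun _ => 0 :=
    (hcont.ae_eq_iff_eq volume continuous_const).mp hae
  exact (sub_eq_zero.mp (congr_fun hzero t)).symm

end HBCS.Diagonalisation

/-! ### BIBO stability -/

namespace HBCS.Diagonalisation

variable {𝕜 : Type*} [RCLike 𝕜] {n : ℕ} {sys : HBCS 𝕜 n} (D : sys.Diagonalisation)

/-- The continuous representative of `H x` vanishes almost everywhere, hence everywhere. At time
zero this provides the compatibility needed to extend inflow and outflow continuously by zero to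
negative times. -/
lemma effort_eq_zero_of_state_eq_zero {z : sys.State} {v : ℝ → EuclideanSpace 𝕜 (Fin n)}
    (hev : sys.Evolution 0 z v) {ξ : ℝ} (hξ : ξ ∈ Icc sys.a sys.b) : D.effort v ξ = 0 := by
  obtain ⟨w, ⟨hw, hv⟩, hx, -⟩ := hev
  have hwi : IntervalIntegrable w volume sys.a sys.b := by
    rw [intervalIntegrable_iff_integrableOn_Icc_of_le sys.hab.le]
    exact hw.integrable one_le_two
  have hvc : ContinuousOn v (Icc sys.a sys.b) := by
    have := intervalIntegral.continuousOn_primitive_interval' hwi left_mem_uIcc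
    rw [uIcc_of_le sys.hab.le] at this
    exact (continuousOn_const.add this).congr hv
  have hae : v =ᵐ[sys.vol] fun _ => 0 := by
    filter_upwards [hx, Lp.coeFn_zero (EuclideanSpace 𝕜 (Fin n)) 2 sys.vol] with ξ h1 h2
    rw [h2] at h1
    ext j
    simpa using congr_fun h1 j
  have hv0 := Measure.eqOn_Icc_of_ae_eq volume sys.hab.ne hae hvc continuousOn_const hξ
  rw [effort, hv0]
  simp

lemma effort_b_eq_mulVec_trace (v : ℝ → EuclideanSpace 𝕜 (Fin n)) :
    D.effort v sys.b = (P1D 𝕜 n D.m * (D.S sys.b * sys.P1)) *ᵥ (sys.trace v ∘ Sum.inl) := by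
  rw [effort, Matrix.mulVec_mulVec, Matrix.mulVec_mulVec, Matrix.mul_assoc]
  rfl

lemma effort_a_eq_mulVec_trace (v : ℝ → EuclideanSpace 𝕜 (Fin n)) :
    D.effort v sys.a = (P1D 𝕜 n D.m * (D.S sys.a * sys.P1)) *ᵥ (sys.trace v ∘ Sum.inr) := by
  rw [effort, Matrix.mulVec_mulVec, Matrix.mulVec_mulVec, Matrix.mul_assoc]
  rfl

/-- The boundary traces of a classical solution are continuous in time. -/
lemma continuousOn_trace (hW : (Matrix.fromRows sys.WB sys.WC).rank = n + n)
    {u y : ℝ → EuclideanSpace 𝕜 (Fin n)} (hu : ContinuousOn u (Ici 0))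
    (hy : ContinuousOn y (Ici 0)) {v : ℝ → ℝ → EuclideanSpace 𝕜 (Fin n)}
    (huv : ∀ t, 0 ≤ t → (u t).ofLp = sys.WB *ᵥ sys.trace (v t))
    (hyv : ∀ t, 0 ≤ t → (y t).ofLp = sys.WC *ᵥ sys.trace (v t)) :
    ContinuousOn (fun t => sys.trace (v t)) (Ici 0) := by
  set N := Matrix.fromRows sys.WB sys.WC with hN
  -- Full rank of the stacked matrix means that input and output together determine the traces,
  -- which therefore inherit their continuity.
  have hunit : IsUnit N := by
    rw [← Matrix.mulVec_surjective_iff_isUnit]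
    have hrange : LinearMap.range N.mulVecLin = ⊤ := by
      refine Submodule.eq_top_of_finrank_eq ?_
      rw [Module.finrank_pi, Fintype.card_sum, Fintype.card_fin]
      exact hW
    exact LinearMap.range_eq_top.mp hrange
  have hinv : N⁻¹ * N = 1 :=
    Matrix.nonsing_inv_mul _ ((Matrix.isUnit_iff_isUnit_det _).mp hunit)
  have heq : ∀ t ∈ Ici (0 : ℝ), sys.trace (v t) =
      N⁻¹ *ᵥ Sum.elim (u t).ofLp (y t).ofLp := by
    intro t ht
    rw [huv t ht, hyv t ht, ← Matrix.fromRows_mulVec, ← hN, Matrix.mulVec_mulVec, hinv,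
      Matrix.one_mulVec]
  refine ContinuousOn.congr ?_ heq
  have hpair : ContinuousOn (fun t => Sum.elim (u t).ofLp (y t).ofLp) (Ici 0) := by
    refine continuousOn_pi.mpr fun j => ?_
    rcases j with j | j
    · exact (EuclideanSpace.proj j : EuclideanSpace 𝕜 (Fin n) →L[𝕜] 𝕜).continuous.comp_continuousOn
        hu
    · exact (EuclideanSpace.proj j : EuclideanSpace 𝕜 (Fin n) →L[𝕜] 𝕜).continuous.comp_continuousOn
        hy
  exact (Continuous.matrix_mulVec continuous_const continuous_id).comp_continuousOn hpair

/-- Inflow and outflow are linked twice, by the transport delay and by the input equation.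
Eliminating the outflow gives the delay equation driven by `K⁻¹ u`, and the output is a bounded
linear function of inflow and outflow. -/
theorem bibo_of_summable (hP1 : IsUnit sys.P1) (hP0 : ∀ᵐ ξ ∂sys.vol, D.P0D ξ = 0)
    (hW : (Matrix.fromRows sys.WB sys.WC).rank = n + n) {K M : Matrix (Fin n) (Fin n) 𝕜}
    (hKM : D.system.IsDecomposition K M)
    (hsum : ∀ p q, Summable fun k : ℕ =>
      ExpPoly.l1Norm ((delayMatrix (complexify M) D.delays ^ k) p q)) :
    sys.BIBOStable := by
  obtain ⟨δ, hδ0, hδ⟩ := D.exists_delay_lower_bound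
  set C₁ : ℝ := ∑ p, ∑ q, ∑' k : ℕ, ExpPoly.l1Norm ((delayMatrix (complexify M) D.delays ^ k) p q)
    with hC₁
  have hC₁0 : 0 ≤ C₁ := Finset.sum_nonneg fun _ _ => Finset.sum_nonneg fun _ _ =>
    tsum_nonneg fun _ => ExpPoly.l1Norm_nonneg _
  let κ : EuclideanSpace 𝕜 (Fin n) →L[𝕜] (Fin n → 𝕜) :=
    LinearMap.toContinuousLinearMap
      ((Matrix.mulVecLin K⁻¹).comp (WithLp.linearEquiv 2 𝕜 (Fin n → 𝕜)).toLinearMap)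
  let γ : (Fin n ⊕ Fin n → 𝕜) →L[𝕜] EuclideanSpace 𝕜 (Fin n) :=
    LinearMap.toContinuousLinearMap
      ((WithLp.linearEquiv 2 𝕜 (Fin n → 𝕜)).symm.toLinearMap.comp
        (Matrix.mulVecLin (sys.WC * D.boundaryTransform)))
  -- The added one only ensures that the constant is positive.
  refine ⟨‖γ‖ * (C₁ * ‖κ‖) + 1, by positivity, ?_⟩
  rintro u x y ⟨hu, hx, hy, hsol⟩ - - hx0 t ht
  choose! v hv using hsol
  have hev : ∀ s, 0 ≤ s → sys.Evolution (x s) (derivWithin x (Ici 0) s) (v s) :=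
    fun s hs => (hv s hs).1
  have hXd : ∀ s, 0 ≤ s → HasDerivWithinAt x (derivWithin x (Ici 0) s) (Ici s) s := fun s hs =>
    ((hx.differentiableOn one_ne_zero s hs).hasDerivWithinAt).mono (Ici_subset_Ici.mpr hs)
  have htr := continuousOn_trace hW hu hy (fun s hs => (hv s hs).2.1) fun s hs => (hv s hs).2.2
  -- Freezing time at zero gives functions on the whole line, as the delay equation requires.
  have hmaxc : Continuous fun s : ℝ => max s 0 := continuous_id.max continuous_const
  have htrc : Continuous fun s => sys.trace (v (max s 0)) :=
    htr.comp_continuous hmaxc fun s => le_max_right s 0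
  have hebc : Continuous fun s => D.effort (v (max s 0)) sys.b := by
    simp_rw [effort_b_eq_mulVec_trace]
    exact Continuous.matrix_mulVec continuous_const
      (continuous_pi fun j => (continuous_apply (Sum.inl j)).comp htrc)
  have heac : Continuous fun s => D.effort (v (max s 0)) sys.a := by
    simp_rw [effort_a_eq_mulVec_trace]
    exact Continuous.matrix_mulVec continuous_const
      (continuous_pi fun j => (continuous_apply (Sum.inr j)).comp htrc)
  let F : Fin n → ℝ → 𝕜 := fun i s => D.inflow (v (max s 0)) i
  let G : Fin n → ℝ → 𝕜 := fun i s => D.outflow (v (max s 0)) i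
  have hF : ∀ i, Continuous (F i) := by
    intro i
    simp only [F, inflow]
    split_ifs
    · exact (continuous_apply i).comp hebc
    · exact (continuous_apply i).comp heac
  have hG : ∀ i, Continuous (G i) := by
    intro i
    simp only [G, outflow]
    split_ifs
    · exact (continuous_apply i).comp heac
    · exact (continuous_apply i).comp hebc
  have hev0 : sys.Evolution 0 (derivWithin x (Ici 0) 0) (v 0) := by
    have := hev 0 le_rfl
    rwa [hx0] at this
  have hea0 := D.effort_eq_zero_of_state_eq_zero hev0 (left_mem_Icc.mpr sys.hab.le)
  have heb0 := D.effort_eq_zero_of_state_eq_zero hev0 (right_mem_Icc.mpr sys.hab.le)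
  have hF0 : ∀ i, ∀ s ≤ 0, F i s = 0 := by
    intro i s hs
    simp [F, inflow, max_eq_right hs, hea0, heb0]
  have hG0 : ∀ i, ∀ s ≤ 0, G i s = 0 := by
    intro i s hs
    simp [G, outflow, max_eq_right hs, hea0, heb0]
  have hGF : ∀ i s, G i s = F i (s - D.travelTime i) := fun i s =>
    D.outflow_eq_inflow_delayed hP1 hP0 hx.continuousOn hXd hev hx0 i (hF i) (hG i) (hF0 i)
      (hG0 i) (fun s hs => by simp only [F, max_eq_left hs])
      (fun s hs => by simp only [G, max_eq_left hs]) s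
  have hKinv : K⁻¹ * K = 1 :=
    Matrix.nonsing_inv_mul _ ((Matrix.isUnit_iff_isUnit_det _).mp hKM.1)
  have hκ : ∀ p s, F p s = ∑ q, M p q * F q (s - D.delays q) + κ (u (max s 0)) p := by
    intro p s
    have h1 : κ (u (max s 0)) = D.inflow (v (max s 0)) - M *ᵥ D.outflow (v (max s 0)) := by
      change K⁻¹ *ᵥ (u (max s 0)).ofLp = _
      rw [(hv _ (le_max_right s 0)).2.1, D.input_eq_of_isDecomposition hP1 hKM,
        Matrix.mulVec_mulVec, hKinv, Matrix.one_mulVec]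
    rw [h1, Pi.sub_apply]
    have h2 : (M *ᵥ D.outflow (v (max s 0))) p = ∑ q, M p q * F q (s - D.delays q) := by
      simp only [Matrix.mulVec, dotProduct]
      refine Finset.sum_congr rfl fun q _ => ?_
      rw [coe_delays, ← hGF q s]
    rw [h2]
    simp [F]
  obtain ⟨hfin, hub⟩ := norm_le_eLpNorm_top_of_continuousOn ht (hu.mono Icc_subset_Ici_self)
  set B := (eLpNorm u ⊤ (volume.restrict (Icc 0 t))).toReal with hB
  have hB0 : 0 ≤ B := ENNReal.toReal_nonneg
  have hFB : ∀ p, ∀ s ≤ t, ‖F p s‖ ≤ C₁ * (‖κ‖ * B) := by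
    intro p s hs
    rw [← RCLike.norm_map_complex]
    refine norm_le_of_delay_equation (τ := D.delays) (M := complexify M)
      (F := fun p s => RCLike.map 𝕜 ℂ (F p s)) (U := fun p s => RCLike.map 𝕜 ℂ (κ (u (max s 0)) p))
      hδ0 (fun i => hδ i) hsum (fun p s hs => by rw [hF0 p s hs, map_zero]) (fun p s => ?_)
      (by positivity) (fun q r hr => ?_) p
    · rw [hκ p s, map_add, map_sum]
      simp_rw [RCLike.map_complex_mul]
      rfl
    · rw [RCLike.norm_map_complex]
      calc ‖κ (u (max r 0)) q‖ ≤ ‖κ (u (max r 0))‖ := norm_le_pi_norm _ _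
        _ ≤ ‖κ‖ * ‖u (max r 0)‖ := κ.le_opNorm _
        _ ≤ ‖κ‖ * B := mul_le_mul_of_nonneg_left
            (hub _ ⟨le_max_right _ _, max_le (hr.trans hs) ht.le⟩) (norm_nonneg _)
  have hGB : ∀ p, ∀ s ≤ t, ‖G p s‖ ≤ C₁ * (‖κ‖ * B) := fun p s hs => by
    rw [hGF]
    exact hFB p _ (by linarith [D.travelTime_pos p])
  have hyB : ∀ s ∈ Icc 0 t, ‖y s‖ ≤ (‖γ‖ * (C₁ * ‖κ‖) + 1) * B := by
    intro s hs
    have h1 : y s = γ (Sum.elim (D.effort (v s) sys.b) (D.effort (v s) sys.a)) := by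
      ext j
      change (y s).ofLp j = ((sys.WC * D.boundaryTransform) *ᵥ _) j
      rw [(hv s hs.1).2.2, ← Matrix.mulVec_mulVec, D.boundaryTransform_mulVec_effort hP1]
    have hFs : ∀ i, ‖D.inflow (v s) i‖ ≤ C₁ * (‖κ‖ * B) := fun i => by
      have := hFB i s hs.2
      simpa only [F, max_eq_left hs.1] using this
    have hGs : ∀ i, ‖D.outflow (v s) i‖ ≤ C₁ * (‖κ‖ * B) := fun i => by
      have := hGB i s hs.2
      simpa only [G, max_eq_left hs.1] using this
    have h2 : ‖Sum.elim (D.effort (v s) sys.b) (D.effort (v s) sys.a)‖ ≤ C₁ * (‖κ‖ * B) := by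
      refine (pi_norm_le_iff_of_nonneg (by positivity)).mpr fun j => ?_
      rcases j with i | i
      · by_cases hi : (i : ℕ) < D.m
        · simpa [inflow, hi] using hFs i
        · simpa [outflow, hi] using hGs i
      · by_cases hi : (i : ℕ) < D.m
        · simpa [outflow, hi] using hGs i
        · simpa [inflow, hi] using hFs i
    rw [h1]
    calc _ ≤ ‖γ‖ * (C₁ * (‖κ‖ * B)) :=
          (γ.le_opNorm _).trans (mul_le_mul_of_nonneg_left h2 (norm_nonneg _))
      _ ≤ (‖γ‖ * (C₁ * ‖κ‖) + 1) * B := by nlinarith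
  calc eLpNorm y ⊤ (volume.restrict (Icc 0 t))
      ≤ ENNReal.ofReal ((‖γ‖ * (C₁ * ‖κ‖) + 1) * B) := by
        rw [eLpNorm_exponent_top]
        exact eLpNormEssSup_le_of_ae_bound
          ((ae_restrict_iff' measurableSet_Icc).mpr (ae_of_all _ hyB))
    _ = _ := by
        rw [ENNReal.ofReal_mul (by positivity), hB, ENNReal.ofReal_toReal hfin]

/-! ### The diagonalised system is its own diagonalisation -/

/-- The trivial diagonalisation of the diagonalised system. -/
def self : D.system.Diagonalisation where
  m := D.m
  m_le := D.m_le
  S := fun _ => 1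
  h := D.h
  S_contDiff := fun _ _ => contDiffOn_const
  S_unit := fun _ _ => isUnit_one
  h_contDiff := D.h_contDiff
  h_pos := D.h_pos
  eq := ae_of_all _ fun ξ => by simp [system]

lemma self_boundaryTransform : D.self.boundaryTransform = 1 := by
  have h1 : (D.system.P1)⁻¹ * ((1 : Matrix (Fin n) (Fin n) 𝕜))⁻¹ * P1D 𝕜 n D.m = 1 := by
    change (P1D 𝕜 n D.m)⁻¹ * _ * _ = 1
    rw [P1D_inv, inv_one, Matrix.mul_one, P1D_mul_self]
  rw [boundaryTransform]
  change Matrix.fromBlocks ((D.system.P1)⁻¹ * ((1 : Matrix (Fin n) (Fin n) 𝕜))⁻¹ * P1D 𝕜 n D.m) 0 0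
    ((D.system.P1)⁻¹ * ((1 : Matrix (Fin n) (Fin n) 𝕜))⁻¹ * P1D 𝕜 n D.m) = 1
  rw [h1, Matrix.fromBlocks_one]

/-- With `S = 1` the derivative term drops out, and what remains is a multiple of the vanishing
`P₀^D`. -/
lemma self_P0D (hP0 : ∀ᵐ ξ ∂sys.vol, D.P0D ξ = 0) : ∀ᵐ ξ ∂D.system.vol, D.self.P0D ξ = 0 := by
  change ∀ᵐ ξ ∂sys.vol, _
  filter_upwards [hP0] with ξ hξ
  have h1 : D.self.derivSInv ξ = 0 := by
    ext i j
    change derivWithin (fun _ : ℝ => ((1 : Matrix (Fin n) (Fin n) 𝕜)⁻¹) i j) (Icc sys.a sys.b) ξ = 0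
    simp
  have h2 : D.system.P0 ξ = 0 := hξ
  rw [P0D, h1, h2]
  simp

lemma self_isDecomposition {K M : Matrix (Fin n) (Fin n) 𝕜} (hKM : D.system.IsDecomposition K M) :
    D.self.system.IsDecomposition K M := by
  refine ⟨hKM.1, ?_⟩
  have h : D.self.system.WB = D.system.WB := by
    change D.system.WB * D.self.boundaryTransform = _
    rw [D.self_boundaryTransform, Matrix.mul_one]
  rw [h, hKM.2]
  rfl

lemma system_rank (hP1 : IsUnit sys.P1) (hW : (Matrix.fromRows sys.WB sys.WC).rank = n + n) :
    (Matrix.fromRows D.system.WB D.system.WC).rank = n + n := by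
  change (Matrix.fromRows (sys.WB * D.boundaryTransform) (sys.WC * D.boundaryTransform)).rank = _
  rw [← Matrix.fromRows_mul, Matrix.rank_mul_eq_left_of_isUnit_det _ _
    ((Matrix.isUnit_iff_isUnit_det _).mp (D.isUnit_boundaryTransform hP1)), hW]

theorem system_bibo_of_summable (hP1 : IsUnit sys.P1) (hP0 : ∀ᵐ ξ ∂sys.vol, D.P0D ξ = 0)
    (hW : (Matrix.fromRows sys.WB sys.WC).rank = n + n) {K M : Matrix (Fin n) (Fin n) 𝕜}
    (hKM : D.system.IsDecomposition K M)
    (hsum : ∀ p q, Summable fun k : ℕ =>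
      ExpPoly.l1Norm ((delayMatrix (complexify M) D.delays ^ k) p q)) :
    D.system.BIBOStable :=
  D.self.bibo_of_summable (IsUnit.of_mul_eq_one _ (P1D_mul_self D.m)) (D.self_P0D hP0)
    (D.system_rank hP1 hW) (D.self_isDecomposition hKM) hsum

end HBCS.Diagonalisation

end

/-! ### The stability theorem -/

theorem mainTheorem1 {𝕜 : Type*} [RCLike 𝕜] {n : ℕ} (sys : HBCS 𝕜 n) (hsys : sys.Admissible)
    (D : sys.Diagonalisation) (hP0 : ∀ᵐ ξ ∂sys.vol, D.P0D ξ = 0) :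
    (∃ K M : Matrix (Fin n) (Fin n) 𝕜, D.system.IsDecomposition K M) ∧
    ∀ K M : Matrix (Fin n) (Fin n) 𝕜, D.system.IsDecomposition K M →
      ((normInftyInfty M < 1 ∨
        (Summable fun k : ℕ => absMatrix M ^ k) ∨
        (∃ k₀ : ℕ, 0 < k₀ ∧ ∀ p, ∑ r, D.system.powVariation M k₀ p r < 1)) →
        (∀ p q, ∑' k : ℕ, D.system.powVariation M k p q < ⊤) ∧
        D.system.BIBOStable ∧ sys.BIBOStable) ∧
      ((∃ ν : AlgebraNorm 𝕜 (Matrix (Fin n) (Fin n) 𝕜), ν (absMatrix M) < 1) →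
        Summable fun k : ℕ => absMatrix M ^ k) := by
  refine ⟨⟨_, _, D.isDecomposition_of_isUnit (D.isUnit_inflowMatrix hsys hP0)⟩,
    fun K M hKM => ⟨fun hM => ?_, fun ⟨ν, hν⟩ => summable_absMatrix_pow_of_algebraNorm M ν hν⟩⟩
  have hsum := D.summable_l1Norm_of_conditions hP0 M hM
  refine ⟨fun p q => ?_, D.system_bibo_of_summable hsys.P1_unit hP0 hsys.WBC_rank hKM hsum,
    D.bibo_of_summable hsys.P1_unit hP0 hsys.WBC_rank hKM hsum⟩
  simp_rw [D.powVariation_system hP0]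
  rw [← ENNReal.ofReal_tsum_of_nonneg (fun _ => ExpPoly.l1Norm_nonneg _) (hsum p q)]
  exact ENNReal.ofReal_lt_top
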